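/- **Conventions.** All Hilbert spaces are complex and separable, $d$ is a natural number, $\mathbb B_d$ is the open Euclidean unit ball of $\mathbb C^d$, and $\langle z,w\rangle=\sum_j z_j\overline{w_j}$. For a Hilbert space $\mathcal Y$, $H^2_d(\mathcal Y)$ is the reproducing kernel Hilbert space of $\mathcal Y$-valued functions on $\mathbb B_d$ with kernel $I_{\mathcal Y}/(1-\langle z,w\rangle)$. The Schur class $\mathcal S_d(\mathcal U,\mathcal Y)$ consists of the holomorphic functions $\varphi:\mathbb B_d\to\mathcal B(\mathcal U,\mathcal Y)$ for which $f\mapsto\varphi f$ is a contraction from $H^2_d(\mathcal U)$ to $H^2_d(\mathcal Y)$. For such $\varphi$, $H(k_\varphi)$ is the reproducing kernel Hilbert space with kernel $k_\varphi(z,w)=\dfrac{I_{\mathcal Y}-\varphi(z)\varphi(w)^*}{1-\langle z,w\rangle}$; it is contained in $H^2_d(\mathcal Y)$. Put $\mathcal U^0_\varphi=\{u\in\mathcal U:\varphi(z)u=0\ \text{for all } z\in\mathbb B_d\}$. Two Schur multipliers $\varphi\in\mathcal S_d(\mathcal U,\mathcal Y)$ and $\psi\in\mathcal S_d(\mathcal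 V,\mathcal W)$ *coincide* if there are unitary operators $\alpha:\mathcal U\to\mathcal V$ and $\beta:\mathcal Y\to\mathcal W$ with $\beta\varphi(z)=\psi(z)\alpha$ for all $z\in\mathbb B_d$. **Colligations.** A colligation is a bounded operator $\begin{pmatrix}A&B\\C&D\end{pmatrix}:\mathcal K\oplus\mathcal U\to\mathcal K^d\oplus\mathcal Y$. Two colligations, with spaces $(\mathcal K_1,\mathcal U,\mathcal Y)$ and $(\mathcal K_2,\mathcal V,\mathcal W)$, are *unitarily coincident* if there are unitary operators $\Lambda:\mathcal K_1\to\mathcal K_2$, $\Omega_1:\mathcal U\to\mathcal V$, $\Omega_2:\mathcal Y\to\mathcal W$ with $$\begin{pmatrix}\Lambda^d&0\\0&\Omega_2\end{pmatrix}\begin{pmatrix}A_1&B_1\\C_1&D_1\end{pmatrix}=\begin{pmatrix}A_2&B_2\\C_2&D_2\end{pmatrix}\begin{pmatrix}\Lambda&0\\0&\Omega_1\end{pmatrix}.$$ A *functional model realization* (or functional model colligation) $U^\varphi$ of $\varphi$ is a contractive colligation with $\mathcal K=H(k_\varphi)$ and $\varphi(z)=D+C(I-ZA)^{-1}ZB$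 for $z\in\mathbb B_d$, where $Z=(z_1I,\dots,z_dI)$, such that $A_j=M_{z_j}^*|_{H(k_\varphi)}$ for each $j$ (with $M_{z_j}$ multiplication by $z_j$ on $H^2_d(\mathcal Y)$), $Cf=f(0)$ and $D=\varphi(0)$. **The canonical modification.** Let $U^\varphi$ be a functional model realization of $\varphi$. * $\mathcal D_\varphi\subseteq H(k_\varphi)^d$ is the closed linear span of the vectors $W^*k_\varphi(\cdot,w)y=(\overline{w_1}k_\varphi(\cdot,w)y,\dots,\overline{w_d}k_\varphi(\cdot,w)y)$, $w\in\mathbb B_d$, $y\in\mathcal Y$. * $R:\mathcal D_\varphi\to\mathcal U$ is the bounded operator with $W^*k_\varphi(\cdot,w)y\mapsto(\varphi(w)^*-\varphi(0)^*)y$. * $T_{11}=A^*|_{\mathcal D_\varphi^\perp}$, and $T_{12}=(A^*|_{\mathcal D_\varphi}\ \ C^*):\mathcal D_\varphi\oplus\mathcal Y\to H(k_\varphi)$, and $T_{22}=(R\ \ \varphi(0)^*):\mathcal D_\varphi\oplus\mathcal Y\to\mathcal U$. * $G_1:\overline{\mathrm{ran}}\,(I-T_{12}T_{12}^*)^{1/2}\to\mathcal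 D_\varphi^\perp$ is given by $(I-T_{12}T_{12}^*)^{1/2}f\mapsto T_{11}^*f$. * $G_2:\overline{\mathrm{ran}}\,(I-T_{12}^*T_{12})^{1/2}\to\mathcal U$ is given by $(I-T_{12}^*T_{12})^{1/2}l\mapsto T_{22}l$. * $\Delta=(I-G_1G_1^*)^{1/2}$ on $\mathcal D_\varphi^\perp$. * $\xi:\overline{\mathrm{ran}}\,\Delta\to\mathcal U^0_\varphi$ is the unique contraction with $B^*|_{\mathcal D_\varphi^\perp}=-G_2T_{12}^*G_1^*+\xi\Delta$. * $\mathcal N=\mathcal U\oplus\overline{\mathrm{ran}}\,\Delta$; $J$ is the partial isometry projecting $\mathcal N$ onto $(\mathcal U^0_\varphi)^\perp\subseteq\mathcal U$; and $\xi_{iso}h=\xi h\oplus(I-\xi^*\xi)^{1/2}h\in\mathcal N$. Then $U^{\varphi_J}$ is the colligation $$U^{\varphi_J}=\begin{pmatrix}A&B^{\varphi_J}\\C&\varphi(0)J\end{pmatrix}:H(k_\varphi)\oplus\mathcal N\to H(k_\varphi)^d\oplus\mathcal Y,$$ $$(B^{\varphi_J})^*=\bigl(-J^*G_2T_{12}^*G_1^*+\xi_{iso}\Delta\quad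 J^*R\bigr):\mathcal D_\varphi^\perp\oplus\mathcal D_\varphi\to\mathcal N,$$ and for a Hilbert space $\mathcal H$, $$U^{\varphi_J}_{\mathcal H}=\begin{pmatrix}A&B^{\varphi_J}&0\\C&\varphi(0)J&0\end{pmatrix}:H(k_\varphi)\oplus(\mathcal N\oplus\mathcal H)\to H(k_\varphi)^d\oplus\mathcal Y.$$ The colligations $U^{\psi_{J'}}$ and $U^{\psi_{J'}}_{\mathcal H}$ are obtained in the same way from a functional model realization $U^\psi$ of $\psi$, and $\mathcal V^0_\psi$ is defined like $\mathcal U^0_\varphi$. **Theorem 3.1.** Let $\varphi\in\mathcal S_d(\mathcal U,\mathcal Y)$ and $\psi\in\mathcal S_d(\mathcal V,\mathcal W)$ both admit functional model realizations. Then the following are equivalent. 1. $\varphi$ coincides with $\psi$. 2. $\dim\mathcal U^0_\varphi=\dim\mathcal V^0_\psi$ (Hilbert space dimension), and for any functional model realizations $U^\varphi$ of $\varphi$ and $U^\psi$ of $\psi$ there is a Hilbert space $\mathcal H$ such that $U^{\varphi_J}_{\mathcal H}$ is unitarily coincident with $U^{\psi_{J'}}$, or $U^{\psi_{J'}}_{\mathcal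 H}$ is unitarily coincident with $U^{\varphi_J}$. -/

import Mathlib

open scoped InnerProductSpace ComplexConjugate

noncomputable section

namespace DruryArvesonSchur

/-- The open Euclidean unit ball of `ℂᵈ`. -/
abbrev Ball (d : ℕ) : Type := Metric.ball (0 : EuclideanSpace ℂ (Fin d)) 1

instance (d : ℕ) : Zero (Ball d) := ⟨⟨0, by simp⟩⟩

/-- The scalar Drury–Arveson kernel `1 / (1 - ⟨z, w⟩)`, where `⟨z, w⟩ = ∑ zⱼ conj wⱼ` is linear in
`z`; Mathlib's inner product is linear in its second argument, whence the order. -/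
def szego {d : ℕ} (z w : Ball d) : ℂ := (1 - ⟪w.1, z.1⟫_ℂ)⁻¹

section Kernels

variable {X V : Type*} [NormedAddCommGroup V] [InnerProductSpace ℂ V] [CompleteSpace V]

lemma posSemidef_iff {K : Matrix X X (V →L[ℂ] V)} :
    K.PosSemidef ↔ K.IsHermitian ∧ ∀ (s : Finset X) (v : X → V),
      0 ≤ RCLike.re (∑ x ∈ s, ∑ y ∈ s, ⟪K y x (v x), v y⟫_ℂ) := by
  classical
  refine ((RKHS.posSemidef_tfae (K := K)).out 0 2).trans ?_
  refine and_congr_right fun _ => ⟨fun h s v => ?_, fun h vv => h vv.support vv⟩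
  have := h (Finsupp.indicator s fun x _ => v x)
  rw [Finsupp.sum_of_support_subset _ (Finsupp.support_indicator_subset _ _) _ (by simp)] at this
  convert! this using 2
  refine Finset.sum_congr rfl fun x hx => ?_
  rw [Finsupp.sum_of_support_subset _ (Finsupp.support_indicator_subset _ _) _ (by simp)]
  refine Finset.sum_congr rfl fun y hy => ?_
  simp [hx, hy]

lemma posSemidef_one : (Matrix.of fun _ _ : X => (1 : V →L[ℂ] V)).PosSemidef := by
  refine posSemidef_iff.2 ⟨by ext; simp, fun s v => ?_⟩
  have : ∑ x ∈ s, ∑ y ∈ s, ⟪(Matrix.of fun _ _ : X => (1 : V →L[ℂ] V)) y x (v x), v y⟫_ℂ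
      = ⟪∑ x ∈ s, v x, ∑ x ∈ s, v x⟫_ℂ := by
    simp only [sum_inner, inner_sum]
    rw [Finset.sum_comm]
    simp
  rw [this]
  exact inner_self_nonneg

lemma posSemidef_congr {K : Matrix X X (V →L[ℂ] V)} (hK : K.PosSemidef) (g : X → ℂ) :
    (Matrix.of fun z w => (g z * conj (g w)) • K z w).PosSemidef := by
  rw [posSemidef_iff] at hK ⊢
  refine ⟨?_, fun s v => ?_⟩
  · ext x y v
    simp only [Matrix.conjTranspose_apply, Matrix.of_apply, star_smul, hK.1.apply]
    simp [mul_comm]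
  · convert! hK.2 s (fun x => conj (g x) • v x) using 1
    congr 1
    refine Finset.sum_congr rfl fun x _ => Finset.sum_congr rfl fun y _ => ?_
    simp only [Matrix.of_apply, FunLike.coe_smul, Pi.smul_apply, map_smul, inner_smul_left, inner_smul_right, map_mul, RCLike.conj_conj]
    ring

lemma posSemidef_lim {K : ℕ → Matrix X X (V →L[ℂ] V)} {L : Matrix X X (V →L[ℂ] V)}
    (hK : ∀ n, (K n).PosSemidef)
    (h : ∀ z w, Filter.Tendsto (fun n => K n z w) Filter.atTop (nhds (L z w))) :
    L.PosSemidef := by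
  simp only [posSemidef_iff] at hK ⊢
  refine ⟨?_, fun s v => ?_⟩
  · ext1 x y
    have := (h y x).star
    simp only [(hK _).1.apply] at this
    exact tendsto_nhds_unique this (h x y)
  · refine ge_of_tendsto' (x := Filter.atTop)
      (f := fun n => RCLike.re (∑ x ∈ s, ∑ y ∈ s, ⟪K n y x (v x), v y⟫_ℂ)) ?_
      (fun n => (hK n).2 s v)
    refine (RCLike.continuous_re.tendsto _).comp ?_
    refine tendsto_finsetSum _ fun x _ => tendsto_finsetSum _ fun y _ => ?_
    refine Filter.Tendsto.inner ?_ tendsto_const_nhds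
    exact ((ContinuousLinearMap.apply ℂ V (v x)).continuous.tendsto _).comp (h y x)

lemma posSemidef_sum {ι : Type*} (s : Finset ι) {K : ι → Matrix X X (V →L[ℂ] V)}
    (hK : ∀ i, (K i).PosSemidef) : (∑ i ∈ s, K i).PosSemidef :=
  Finset.sum_induction K _ (fun _ _ ha hb => ha.add hb) .zero fun i _ => hK i

end Kernels

section DruryArveson

variable (d : ℕ) (Y : Type*) [NormedAddCommGroup Y] [InnerProductSpace ℂ Y] [CompleteSpace Y]

/-- The operator-valued kernel `k(z, w) = I / (1 - ⟨z, w⟩)`. -/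
def arvesonKernel : Matrix (Ball d) (Ball d) (Y →L[ℂ] Y) :=
  .of fun z w => szego z w • (1 : Y →L[ℂ] Y)

variable {d}

lemma norm_inner_ball_lt (z w : Ball d) : ‖⟪w.1, z.1⟫_ℂ‖ < 1 := by
  have hz : ‖z.1‖ < 1 := mem_ball_zero_iff.1 z.2
  have hw : ‖w.1‖ < 1 := mem_ball_zero_iff.1 w.2
  exact (norm_inner_le_norm _ _).trans_lt
    (mul_lt_one_of_nonneg_of_lt_one_left (norm_nonneg _) hw hz.le)

lemma one_sub_inner_ne_zero (z w : Ball d) : 1 - ⟪w.1, z.1⟫_ℂ ≠ 0 := fun h => by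
  have := norm_inner_ball_lt z w
  rw [← sub_eq_zero.1 h] at this
  simp at this

lemma inner_ball_eq (z w : Ball d) : ⟪w.1, z.1⟫_ℂ = ∑ i, z.1 i * conj (w.1 i) := by
  simp [PiLp.inner_apply]

lemma posSemidef_inner_mul {K : Matrix (Ball d) (Ball d) (Y →L[ℂ] Y)} (hK : K.PosSemidef)
    (s : Finset (Fin d)) :
    (Matrix.of fun z w : Ball d => (∑ i ∈ s, z.1 i * conj (w.1 i)) • K z w).PosSemidef := by
  convert! posSemidef_sum s (fun i => posSemidef_congr hK fun z : Ball d => z.1 i) using 1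
  ext1 z w
  simp [Matrix.sum_apply, Finset.sum_smul]

variable (d) in
lemma posSemidef_arvesonKernel : (arvesonKernel d Y).PosSemidef := by
  have hpow : ∀ n : ℕ,
      (Matrix.of fun z w : Ball d => (⟪w.1, z.1⟫_ℂ ^ n) • (1 : Y →L[ℂ] Y)).PosSemidef := by
    intro n
    induction n with
    | zero => simpa using posSemidef_one
    | succ n ih =>
      convert! posSemidef_inner_mul Y ih Finset.univ using 1
      ext1 z w
      simp only [Matrix.of_apply, smul_smul, ← inner_ball_eq, pow_succ']
  refine posSemidef_lim (fun n => posSemidef_sum (Finset.range n) hpow) fun z w => ?_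
  have := (hasSum_geometric_of_norm_lt_one (norm_inner_ball_lt z w)).tendsto_sum_nat
  simpa [Matrix.sum_apply, ← Finset.sum_smul, arvesonKernel, szego] using
    this.smul_const (1 : Y →L[ℂ] Y)

instance : Fact (arvesonKernel d Y).PosSemidef := ⟨posSemidef_arvesonKernel d Y⟩

variable (d) in
/-- The `Y`-valued Drury–Arveson space: the reproducing kernel Hilbert space of `Y`-valued functions
on the ball with kernel `I / (1 - ⟨z, w⟩)`. -/
def DruryArveson : Type _ := RKHS.OfKernel (arvesonKernel d Y)

instance : NormedAddCommGroup (DruryArveson d Y) :=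
  inferInstanceAs (NormedAddCommGroup (RKHS.OfKernel (arvesonKernel d Y)))

instance : InnerProductSpace ℂ (DruryArveson d Y) :=
  inferInstanceAs (InnerProductSpace ℂ (RKHS.OfKernel (arvesonKernel d Y)))

instance : CompleteSpace (DruryArveson d Y) :=
  inferInstanceAs (CompleteSpace (RKHS.OfKernel (arvesonKernel d Y)))

instance : RKHS ℂ (DruryArveson d Y) (Ball d) Y :=
  inferInstanceAs (RKHS ℂ (RKHS.OfKernel (arvesonKernel d Y)) (Ball d) Y)

variable (d) in
lemma kernel_druryArveson : RKHS.kernel (DruryArveson d Y) = arvesonKernel d Y :=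
  RKHS.OfKernel.kernel_ofKernel

lemma posSemidef_coord (j : Fin d) :
    (Matrix.of fun z w : Ball d =>
      ((1 - z.1 j * conj (w.1 j)) * szego z w) • (1 : Y →L[ℂ] Y)).PosSemidef := by
  classical
  convert! posSemidef_one.add (posSemidef_inner_mul Y (posSemidef_arvesonKernel d Y)
    (Finset.univ.erase j)) using 1
  ext1 z w
  have h := inner_ball_eq z w
  rw [← Finset.add_sum_erase _ _ (Finset.mem_univ j)] at h
  have h0 := one_sub_inner_ne_zero z w
  have : (1 - z.1 j * conj (w.1 j)) * szego z w
      = 1 + (∑ i ∈ Finset.univ.erase j, z.1 i * conj (w.1 i)) * szego z w := by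
    rw [szego]
    field_simp
    rw [h]
    ring
  simp [this, add_smul, arvesonKernel, smul_smul]

/-- Each coordinate function is a bounded multiplier of the Drury–Arveson space. -/
lemma exists_coordMul (j : Fin d) : ∃ M : DruryArveson d Y →L[ℂ] DruryArveson d Y,
    ∀ (f : DruryArveson d Y) (z : Ball d), M f z = z.1 j • f z := by
  classical
  let H := DruryArveson d Y
  let e : (Ball d →₀ Y) →ₗ[ℂ] H := Finsupp.lsum ℂ fun w => (RKHS.kerFun H w).toLinearMap
  let f : (Ball d →₀ Y) →ₗ[ℂ] H :=
    Finsupp.lsum ℂ fun w => conj (w.1 j) • (RKHS.kerFun H w).toLinearMap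
  have hdense : DenseRange e := by
    have : Dense ((LinearMap.range e : Submodule ℂ H) : Set H) := by
      rw [Submodule.dense_iff_topologicalClosure_eq_top, eq_top_iff, ← RKHS.kerFun_dense H]
      refine Submodule.topologicalClosure_mono (Submodule.span_le.2 ?_)
      rintro _ ⟨x, v, rfl⟩
      exact ⟨Finsupp.single x v, by simp [e]⟩
    exact this
  have hk : ∀ (x y : Ball d) (v v' : Y),
      ⟪RKHS.kerFun H x v, RKHS.kerFun H y v'⟫_ℂ = ⟪szego y x • v, v'⟫_ℂ := by
    intro x y v v'
    rw [← RKHS.kernel_inner, kernel_druryArveson]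
    rfl
  have hbound : ∀ x, ‖f x‖ ≤ 1 * ‖e x‖ := by
    intro v
    rw [one_mul]
    refine le_of_sq_le_sq ?_ (norm_nonneg _)
    have h := (posSemidef_iff.1 (posSemidef_coord Y j)).2 v.support v
    rw [← sub_nonneg, ← inner_self_eq_norm_sq (𝕜 := ℂ), ← inner_self_eq_norm_sq (𝕜 := ℂ), ← map_sub]
    convert! h using 2
    have he : ⟪e v, e v⟫_ℂ = ∑ x ∈ v.support, ∑ y ∈ v.support, ⟪szego y x • v x, v y⟫_ℂ := by
      simp only [e, Finsupp.lsum_apply, Finsupp.sum]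
      rw [sum_inner]
      refine Finset.sum_congr rfl fun x _ => ?_
      simp only [inner_sum]
      exact Finset.sum_congr rfl fun y _ => hk x y _ _
    have hf : ⟪f v, f v⟫_ℂ = ∑ x ∈ v.support, ∑ y ∈ v.support,
        ⟪(y.1 j * conj (x.1 j) * szego y x) • v x, v y⟫_ℂ := by
      simp only [f, Finsupp.lsum_apply, Finsupp.sum]
      rw [sum_inner]
      refine Finset.sum_congr rfl fun x _ => ?_
      simp only [inner_sum]
      refine Finset.sum_congr rfl fun y _ => ?_
      have := hk x y (v x) (v y)
      simp only [LinearMap.smul_apply, ContinuousLinearMap.coe_coe, inner_smul_left,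
        inner_smul_right, this, map_mul, RCLike.conj_conj]
      ring
    rw [he, hf]
    simp only [← Finset.sum_sub_distrib]
    refine Finset.sum_congr rfl fun x _ => Finset.sum_congr rfl fun y _ => ?_
    rw [← inner_sub_left, ← sub_smul, ← one_sub_mul]
    rfl
  refine ⟨(f.extendOfNorm e).adjoint, fun g z => ?_⟩
  refine ext_inner_left ℂ fun v => ?_
  have h1 : f.extendOfNorm e (RKHS.kerFun H z v) = conj (z.1 j) • RKHS.kerFun H z v := by
    have := LinearMap.extendOfNorm_eq hdense ⟨1, hbound⟩ (Finsupp.single z v)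
    simpa [e, f] using this
  rw [← RKHS.kerFun_inner, ContinuousLinearMap.adjoint_inner_right, h1, inner_smul_left,
    RKHS.kerFun_inner, inner_smul_right, RCLike.conj_conj]

end DruryArveson

section Schur

variable {d : ℕ} {U Y : Type*}
  [NormedAddCommGroup U] [InnerProductSpace ℂ U] [CompleteSpace U]
  [NormedAddCommGroup Y] [InnerProductSpace ℂ Y] [CompleteSpace Y]

/-- The operator `M_{z_j}` of multiplication by the `j`-th coordinate. -/
def coordMul (Y : Type*) [NormedAddCommGroup Y] [InnerProductSpace ℂ Y] [CompleteSpace Y]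
    (j : Fin d) : DruryArveson d Y →L[ℂ] DruryArveson d Y :=
  (exists_coordMul Y j).choose

lemma coordMul_apply (j : Fin d) (f : DruryArveson d Y) (z : Ball d) :
    coordMul Y j f z = z.1 j • f z :=
  (exists_coordMul Y j).choose_spec f z

variable (d U Y) in
/-- A Schur multiplier: a holomorphic operator-valued function on the ball such that multiplication
by it is a contraction between the vector-valued Drury–Arveson spaces. (`Function.extend` only
extends the function by zero off the ball, so that differentiability on the open ball can be
spoken of.) -/
structure SchurMultiplier where
  toFun : Ball d → U →L[ℂ] Y
  holomorphic : DifferentiableOn ℂ (Function.extend Subtype.val toFun 0)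
    (Metric.ball (0 : EuclideanSpace ℂ (Fin d)) 1)
  exists_mul : ∃ M : DruryArveson d U →L[ℂ] DruryArveson d Y, ‖M‖ ≤ 1 ∧
    ∀ (f : DruryArveson d U) (z : Ball d), M f z = toFun z (f z)

namespace SchurMultiplier

instance : CoeFun (SchurMultiplier d U Y) fun _ => Ball d → U →L[ℂ] Y := ⟨toFun⟩

variable (φ : SchurMultiplier d U Y)

/-- The kernel `k_φ(z, w) = (I - φ(z) φ(w)*) / (1 - ⟨z, w⟩)`. -/
def kernel : Matrix (Ball d) (Ball d) (Y →L[ℂ] Y) :=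
  .of fun z w => szego z w • (1 - φ z ∘L (φ w).adjoint)

lemma posSemidef_kernel : φ.kernel.PosSemidef := by
  obtain ⟨M, hM, hMφ⟩ := φ.exists_mul
  have hker : ∀ (w : Ball d) (y : Y), M.adjoint (RKHS.kerFun (DruryArveson d Y) w y)
      = RKHS.kerFun (DruryArveson d U) w ((φ w).adjoint y) := by
    intro w y
    refine ext_inner_right ℂ fun f => ?_
    rw [ContinuousLinearMap.adjoint_inner_left, RKHS.kerFun_inner, RKHS.kerFun_inner, hMφ,
      ContinuousLinearMap.adjoint_inner_left]
  have hkY : ∀ (x y : Ball d) (v v' : Y), ⟪RKHS.kerFun (DruryArveson d Y) x v,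
      RKHS.kerFun (DruryArveson d Y) y v'⟫_ℂ = ⟪szego y x • v, v'⟫_ℂ := by
    intro x y v v'
    rw [← RKHS.kernel_inner, kernel_druryArveson]
    rfl
  have hkU : ∀ (x y : Ball d) (v v' : U), ⟪RKHS.kerFun (DruryArveson d U) x v,
      RKHS.kerFun (DruryArveson d U) y v'⟫_ℂ = ⟪szego y x • v, v'⟫_ℂ := by
    intro x y v v'
    rw [← RKHS.kernel_inner, kernel_druryArveson]
    rfl
  rw [posSemidef_iff]
  constructor
  · ext x y v
    simp [kernel, Matrix.conjTranspose_apply, star_smul, szego, ContinuousLinearMap.star_eq_adjoint,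
      ContinuousLinearMap.adjoint_comp]
  · intro s v
    let F : DruryArveson d Y := ∑ x ∈ s, RKHS.kerFun (DruryArveson d Y) x (v x)
    have h1 : ⟪F, F⟫_ℂ = ∑ x ∈ s, ∑ y ∈ s, ⟪szego y x • v x, v y⟫_ℂ := by
      simp only [F]
      rw [sum_inner]
      refine Finset.sum_congr rfl fun x _ => ?_
      simp only [inner_sum]
      exact Finset.sum_congr rfl fun y _ => hkY x y _ _
    have h2 : ⟪M.adjoint F, M.adjoint F⟫_ℂ = ∑ x ∈ s, ∑ y ∈ s,
        ⟪szego y x • (φ y) ((φ x).adjoint (v x)), v y⟫_ℂ := by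
      simp only [F, map_sum, hker]
      rw [sum_inner]
      refine Finset.sum_congr rfl fun x _ => ?_
      simp only [inner_sum]
      refine Finset.sum_congr rfl fun y _ => ?_
      rw [hkU, ContinuousLinearMap.adjoint_inner_right, map_smul]
    have h3 : ∑ x ∈ s, ∑ y ∈ s, ⟪φ.kernel y x (v x), v y⟫_ℂ
        = ⟪F, F⟫_ℂ - ⟪M.adjoint F, M.adjoint F⟫_ℂ := by
      rw [h1, h2]
      simp only [← Finset.sum_sub_distrib]
      refine Finset.sum_congr rfl fun x _ => Finset.sum_congr rfl fun y _ => ?_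
      rw [← inner_sub_left, ← smul_sub]
      rfl
    rw [h3, map_sub, sub_nonneg, inner_self_eq_norm_sq, inner_self_eq_norm_sq]
    refine pow_le_pow_left₀ (norm_nonneg _) ?_ 2
    refine (M.adjoint.le_opNorm F).trans ?_
    rw [LinearIsometryEquiv.norm_map]
    exact mul_le_of_le_one_left (norm_nonneg _) hM

instance : Fact φ.kernel.PosSemidef := ⟨φ.posSemidef_kernel⟩

/-- The de Branges–Rovnyak space `H(k_φ)`: the reproducing kernel Hilbert space of `k_φ`. -/
def DeBrangesRovnyak : Type _ := RKHS.OfKernel φ.kernel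

instance : NormedAddCommGroup φ.DeBrangesRovnyak :=
  inferInstanceAs (NormedAddCommGroup (RKHS.OfKernel φ.kernel))

instance : InnerProductSpace ℂ φ.DeBrangesRovnyak :=
  inferInstanceAs (InnerProductSpace ℂ (RKHS.OfKernel φ.kernel))

instance : CompleteSpace φ.DeBrangesRovnyak :=
  inferInstanceAs (CompleteSpace (RKHS.OfKernel φ.kernel))

instance : RKHS ℂ φ.DeBrangesRovnyak (Ball d) Y :=
  inferInstanceAs (RKHS ℂ (RKHS.OfKernel φ.kernel) (Ball d) Y)

lemma kernel_deBrangesRovnyak : RKHS.kernel φ.DeBrangesRovnyak = φ.kernel :=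
  RKHS.OfKernel.kernel_ofKernel

/-- The Hilbert space direct sum `H(k_φ)ᵈ`. -/
abbrev Column : Type _ := PiLp 2 fun _ : Fin d => φ.DeBrangesRovnyak

/-- The subspace `{u | φ(z) u = 0 for all z}`. -/
def nullSpace : Submodule ℂ U := ⨅ z, LinearMap.ker (φ z).toLinearMap

end SchurMultiplier

end Schur

section Colligations

/-- A colligation `(A B; C D) : K ⊕ U → Kᵈ ⊕ Y`, given by its blocks. -/
structure Colligation (d : ℕ) (K U Y : Type*)
    [NormedAddCommGroup K] [InnerProductSpace ℂ K]
    [NormedAddCommGroup U] [InnerProductSpace ℂ U]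
    [NormedAddCommGroup Y] [InnerProductSpace ℂ Y] where
  A : K →L[ℂ] PiLp 2 fun _ : Fin d => K
  B : U →L[ℂ] PiLp 2 fun _ : Fin d => K
  C : K →L[ℂ] Y
  D : U →L[ℂ] Y

namespace Colligation

variable {d : ℕ} {K U Y K' U' Y' : Type*}
  [NormedAddCommGroup K] [InnerProductSpace ℂ K]
  [NormedAddCommGroup U] [InnerProductSpace ℂ U]
  [NormedAddCommGroup Y] [InnerProductSpace ℂ Y]
  [NormedAddCommGroup K'] [InnerProductSpace ℂ K']
  [NormedAddCommGroup U'] [InnerProductSpace ℂ U']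
  [NormedAddCommGroup Y'] [InnerProductSpace ℂ Y']

/-- The colligation operator `K ⊕ U → Kᵈ ⊕ Y` is a contraction. -/
def IsContractive (c : Colligation d K U Y) : Prop :=
  ∀ (x : K) (u : U), ‖c.A x + c.B u‖ ^ 2 + ‖c.C x + c.D u‖ ^ 2 ≤ ‖x‖ ^ 2 + ‖u‖ ^ 2

/-- The row operator `Z = (z₁ I, …, z_d I) : Kᵈ → K`. -/
def row (K : Type*) [NormedAddCommGroup K] [InnerProductSpace ℂ K] (z : Ball d) :
    (PiLp 2 fun _ : Fin d => K) →L[ℂ] K :=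
  ∑ j, z.1 j • PiLp.proj 2 (fun _ : Fin d => K) j

/-- The transfer function `D + C (I - Z A)⁻¹ Z B`. For a contractive colligation `I - Z A` is
invertible, since `‖Z‖ < 1`; `Ring.inverse` is then the inverse. -/
def transfer (c : Colligation d K U Y) (z : Ball d) : U →L[ℂ] Y :=
  c.D + c.C ∘L Ring.inverse (1 - row K z ∘L c.A) ∘L row K z ∘L c.B

/-- Unitary coincidence: `(Λᵈ ⊕ Ω₂) (A B; C D) = (A' B'; C' D') (Λ ⊕ Ω₁)` for some unitary operators
`Λ`, `Ω₁`, `Ω₂`. -/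
def UnitarilyCoincident (c : Colligation d K U Y) (c' : Colligation d K' U' Y') : Prop :=
  ∃ (Λ : K ≃ₗᵢ[ℂ] K') (Ω₁ : U ≃ₗᵢ[ℂ] U') (Ω₂ : Y ≃ₗᵢ[ℂ] Y'), ∀ (x : K) (u : U),
    LinearIsometryEquiv.piLpCongrRight 2 (fun _ : Fin d => Λ) (c.A x + c.B u)
        = c'.A (Λ x) + c'.B (Ω₁ u) ∧
      Ω₂ (c.C x + c.D u) = c'.C (Λ x) + c'.D (Ω₁ u)

/-- The colligation `(A B 0; C D 0) : K ⊕ (U ⊕ H) → Kᵈ ⊕ Y`. -/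
def augment (c : Colligation d K U Y) (H : Type*) [NormedAddCommGroup H]
    [InnerProductSpace ℂ H] : Colligation d K (WithLp 2 (U × H)) Y where
  A := c.A
  B := c.B ∘L WithLp.fstL 2 ℂ U H
  C := c.C
  D := c.D ∘L WithLp.fstL 2 ℂ U H

end Colligation

end Colligations

section Extension

variable {E F G : Type*} [AddCommGroup E] [Module ℂ E]
  [NormedAddCommGroup F] [InnerProductSpace ℂ F]
  [NormedAddCommGroup G] [InnerProductSpace ℂ G] [CompleteSpace G]

/-- The closure of the range of an operator. -/
abbrev rangeClosure (S : E →ₗ[ℂ] F) : Submodule ℂ F := (LinearMap.range S).topologicalClosure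

/-- An operator with its codomain restricted to the closure of its range. -/
def toRangeClosure (S : E →ₗ[ℂ] F) : E →ₗ[ℂ] rangeClosure S :=
  S.codRestrict _ fun x => Submodule.le_topologicalClosure _ ⟨x, rfl⟩

lemma denseRange_toRangeClosure (S : E →ₗ[ℂ] F) : DenseRange (toRangeClosure S) := by
  intro x
  rw [Topology.IsInducing.subtypeVal.closure_eq_preimage_closure_image, ← Set.range_comp]
  exact x.2

/-- The bounded operator on the closure of the range of `S` given by `S x ↦ T x`; meaningful when
`‖T x‖ ≤ c ‖S x‖` for some constant `c`, see `extendAlong_apply`. -/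
def extendAlong (S : E →ₗ[ℂ] F) (T : E →ₗ[ℂ] G) : rangeClosure S →L[ℂ] G :=
  T.extendOfNorm (toRangeClosure S)

lemma extendAlong_apply {S : E →ₗ[ℂ] F} {T : E →ₗ[ℂ] G} (h : ∃ c, ∀ x, ‖T x‖ ≤ c * ‖S x‖) (x : E) :
    extendAlong S T (toRangeClosure S x) = T x :=
  LinearMap.extendOfNorm_eq (denseRange_toRangeClosure S) h x


variable {K L : Type*} [NormedAddCommGroup K] [InnerProductSpace ℂ K] [CompleteSpace K]
  [NormedAddCommGroup L] [InnerProductSpace ℂ L] [CompleteSpace L]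

/-- The defect operator `(I - T* T)^{1/2}`. -/
def defectOp (T : K →L[ℂ] L) : K →L[ℂ] K := CFC.sqrt (1 - T.adjoint ∘L T)

end Extension

section FunctionalModels

variable {d : ℕ} {U Y : Type*}
  [NormedAddCommGroup U] [InnerProductSpace ℂ U] [CompleteSpace U]
  [NormedAddCommGroup Y] [InnerProductSpace ℂ Y] [CompleteSpace Y]

/-- A functional model realization of `φ`: a contractive colligation with state space `H(k_φ)` and
transfer function `φ`, such that `A_j` is the restriction of the backward shift `M_{z_j}*` of
the Drury–Arveson space to `H(k_φ)` (elements of both spaces being compared as functions on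
the ball), `C f = f(0)` and `D = φ(0)`. -/
structure FunctionalModel (φ : SchurMultiplier d U Y) extends
    Colligation d φ.DeBrangesRovnyak U Y where
  contractive : toColligation.IsContractive
  transfer_eq : ∀ z, toColligation.transfer z = φ z
  A_eq : ∀ (f : φ.DeBrangesRovnyak) (j : Fin d), ∃ F : DruryArveson d Y,
    (∀ z, F z = f z) ∧ ∀ z, (A f j) z = ((coordMul Y j).adjoint F) z
  C_eq : ∀ f : φ.DeBrangesRovnyak, C f = f 0
  D_eq : D = φ 0

namespace SchurMultiplier

variable (φ : SchurMultiplier d U Y)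

/-- The linear map from finitely supported families to `H(k_φ)ᵈ` that sends the family with the single
entry `y` at `w` to `W* k_φ(·, w) y = (conj w₁ k_φ(·, w) y, …, conj w_d k_φ(·, w) y)`. Its range is
the linear span of these vectors. -/
def shiftedKernel : (Ball d →₀ Y) →ₗ[ℂ] φ.Column :=
  Finsupp.lsum ℂ fun w =>
    { toFun := fun y => WithLp.toLp 2 fun j => conj (w.1 j) • RKHS.kerFun φ.DeBrangesRovnyak w y
      map_add' := fun y y' => by ext j : 1; simp
      map_smul' := fun c y => by ext j : 1; simp [smul_comm c] }

lemma shiftedKernel_single (w : Ball d) (y : Y) (j : Fin d) :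
    φ.shiftedKernel (Finsupp.single w y) j
      = conj (w.1 j) • RKHS.kerFun φ.DeBrangesRovnyak w y := by
  rw [shiftedKernel, Finsupp.lsum_single]
  rfl

/-- The closed linear span `𝒟_φ` of the vectors `W* k_φ(·, w) y`. -/
def DSpace : Submodule ℂ φ.Column := rangeClosure φ.shiftedKernel

instance : CompleteSpace φ.DSpace := inferInstanceAs (CompleteSpace (rangeClosure _))

/-- The operator `𝒟_φ → U` with `W* k_φ(·, w) y ↦ (φ(w)* - φ(0)*) y`. -/
def R : φ.DSpace →L[ℂ] U :=
  extendAlong φ.shiftedKernel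
    (Finsupp.lsum ℂ fun w => ((φ w).adjoint - (φ 0).adjoint).toLinearMap)

end SchurMultiplier

namespace FunctionalModel

variable {φ : SchurMultiplier d U Y} (c : FunctionalModel φ)

/-- `T₁₁ = A*` restricted to `𝒟_φᗮ`. -/
def T₁₁ : φ.DSpaceᗮ →L[ℂ] φ.DeBrangesRovnyak := c.A.adjoint ∘L φ.DSpaceᗮ.subtypeL

/-- `T₁₂ = (A* restricted to 𝒟_φ, C*) : 𝒟_φ ⊕ Y → H(k_φ)`. -/
def T₁₂ : WithLp 2 (φ.DSpace × Y) →L[ℂ] φ.DeBrangesRovnyak :=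
  c.A.adjoint ∘L φ.DSpace.subtypeL ∘L WithLp.fstL 2 ℂ φ.DSpace Y
    + c.C.adjoint ∘L WithLp.sndL 2 ℂ φ.DSpace Y

end FunctionalModel

/-- `T₂₂ = (R, φ(0)*) : 𝒟_φ ⊕ Y → U`. -/
def SchurMultiplier.T₂₂ (φ : SchurMultiplier d U Y) : WithLp 2 (φ.DSpace × Y) →L[ℂ] U :=
  φ.R ∘L WithLp.fstL 2 ℂ φ.DSpace Y + (φ 0).adjoint ∘L WithLp.sndL 2 ℂ φ.DSpace Y

namespace FunctionalModel

variable {φ : SchurMultiplier d U Y} (c : FunctionalModel φ)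

/-- `(I - T₁₂ T₁₂*)^{1/2}` on `H(k_φ)`. -/
def S₁ : φ.DeBrangesRovnyak →L[ℂ] φ.DeBrangesRovnyak :=
  defectOp c.T₁₂.adjoint

/-- `(I - T₁₂* T₁₂)^{1/2}` on `𝒟_φ ⊕ Y`. -/
def S₂ : WithLp 2 (φ.DSpace × Y) →L[ℂ] WithLp 2 (φ.DSpace × Y) :=
  defectOp c.T₁₂

/-- `G₁ : closure of ran (I - T₁₂ T₁₂*)^{1/2} → 𝒟_φᗮ`, `(I - T₁₂ T₁₂*)^{1/2} f ↦ T₁₁* f`. -/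
def G₁ : rangeClosure c.S₁.toLinearMap →L[ℂ] φ.DSpaceᗮ :=
  extendAlong c.S₁.toLinearMap c.T₁₁.adjoint.toLinearMap

/-- `G₂ : closure of ran (I - T₁₂* T₁₂)^{1/2} → U`, `(I - T₁₂* T₁₂)^{1/2} l ↦ T₂₂ l`. -/
def G₂ : rangeClosure c.S₂.toLinearMap →L[ℂ] U :=
  extendAlong c.S₂.toLinearMap φ.T₂₂.toLinearMap

/-- The product `G₂ T₁₂* G₁* : 𝒟_φᗮ → U`. As `T₁₂*` maps `closure of ran (I - T₁₂ T₁₂*)^{1/2}` into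
`closure of ran (I - T₁₂* T₁₂)^{1/2}`, the projection onto the latter changes nothing; it only
adjusts the codomain. -/
def G₂T₁₂G₁ : φ.DSpaceᗮ →L[ℂ] U :=
  c.G₂ ∘L (rangeClosure c.S₂.toLinearMap).orthogonalProjectionOnto ∘L c.T₁₂.adjoint ∘L
    (rangeClosure c.S₁.toLinearMap).subtypeL ∘L c.G₁.adjoint

/-- `(I - G₁ G₁*)^{1/2}` on `𝒟_φᗮ`. -/
def Δ : φ.DSpaceᗮ →L[ℂ] φ.DSpaceᗮ := defectOp c.G₁.adjoint

/-- The closure of the range of `(I - G₁ G₁*)^{1/2}`. -/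
abbrev DefectSpace : Submodule ℂ φ.DSpaceᗮ := rangeClosure c.Δ.toLinearMap

/-- The Hilbert space `N = U ⊕ closure of ran (I - G₁ G₁*)^{1/2}`. -/
abbrev N : Type _ := WithLp 2 (U × c.DefectSpace)

/-- The partial isometry `J` projecting `N` onto the orthogonal complement of `{u | φ(z) u ≡ 0}` in
`U`, regarded as an operator into `U`. -/
def J : c.N →L[ℂ] U := φ.nullSpaceᗮ.starProjection ∘L WithLp.fstL 2 ℂ U c.DefectSpace

/-- The component `X` in `B* = (X, R) : 𝒟_φᗮ ⊕ 𝒟_φ → U`. -/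
def X : φ.DSpaceᗮ →L[ℂ] U := c.B.adjoint ∘L φ.DSpaceᗮ.subtypeL

/-- The contraction `ξ` with `X = -G₂ T₁₂* G₁* + ξ (I - G₁ G₁*)^{1/2}`, that is,
`(I - G₁ G₁*)^{1/2} h ↦ X h + G₂ T₁₂* G₁* h`. Its values lie in `{u | φ(z) u ≡ 0}`. -/
def ξ : c.DefectSpace →L[ℂ] U :=
  extendAlong c.Δ.toLinearMap (c.X + c.G₂T₁₂G₁).toLinearMap

/-- The defect operator `(I - ξ* ξ)^{1/2}`. -/
def Δξ : c.DefectSpace →L[ℂ] c.DefectSpace := defectOp c.ξ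

/-- The isometry `h ↦ ξ h ⊕ (I - ξ* ξ)^{1/2} h` into `N`. -/
def ξiso : c.DefectSpace →L[ℂ] c.N :=
  (WithLp.prodContinuousLinearEquiv 2 ℂ U c.DefectSpace).symm.toContinuousLinearMap ∘L
    c.ξ.prod c.Δξ

/-- `(I - G₁ G₁*)^{1/2}` as an operator into the closure of its range. -/
def toDefect : φ.DSpaceᗮ →L[ℂ] c.DefectSpace :=
  c.Δ.codRestrict _ fun x => Submodule.le_topologicalClosure _ ⟨x, rfl⟩

/-- The operator `(-J* G₂ T₁₂* G₁* + ξ_iso (I - G₁ G₁*)^{1/2}, J* R) : 𝒟_φᗮ ⊕ 𝒟_φ → N`. -/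
def BJadjoint : φ.Column →L[ℂ] c.N :=
  (-(c.J.adjoint ∘L c.G₂T₁₂G₁) + c.ξiso ∘L c.toDefect) ∘L φ.DSpaceᗮ.orthogonalProjectionOnto
    + c.J.adjoint ∘L φ.R ∘L φ.DSpace.orthogonalProjectionOnto

/-- The canonically modified colligation `U^{φ_J}`, the coisometric functional model realization of
`φ_J(z) = φ(z) J` obtained from a functional model realization of `φ`. -/
def canonical : Colligation d φ.DeBrangesRovnyak c.N Y where
  A := c.A
  B := c.BJadjoint.adjoint
  C := c.C
  D := φ 0 ∘L c.J

end FunctionalModel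

end FunctionalModels

section Coincidence

/-- Coincidence of Schur multipliers: `β φ(z) = ψ(z) α` for all `z`, with `α`, `β` unitary. -/
def Coincide {d : ℕ} {U Y V W : Type*}
    [NormedAddCommGroup U] [InnerProductSpace ℂ U] [CompleteSpace U]
    [NormedAddCommGroup Y] [InnerProductSpace ℂ Y] [CompleteSpace Y]
    [NormedAddCommGroup V] [InnerProductSpace ℂ V] [CompleteSpace V]
    [NormedAddCommGroup W] [InnerProductSpace ℂ W] [CompleteSpace W]
    (φ : SchurMultiplier d U Y) (ψ : SchurMultiplier d V W) : Prop :=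
  ∃ (α : U ≃ₗᵢ[ℂ] V) (β : Y ≃ₗᵢ[ℂ] W), ∀ (z : Ball d) (u : U), β (φ z u) = ψ z (α u)

/-- The Hilbert space dimension: the cardinality of an orthonormal basis (all of them have the same
one, so the infimum is that cardinality). -/
def hilbertDim (E : Type*) [NormedAddCommGroup E] [InnerProductSpace ℂ E] : Cardinal :=
  sInf {κ | ∃ s : Set E, Orthonormal ℂ ((↑) : s → E) ∧
    (Submodule.span ℂ s).topologicalClosure = ⊤ ∧ Cardinal.mk s = κ}

end Coincidence

end DruryArvesonSchur

end

open DruryArvesonSchur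

universe u y v w

/-!
The transfer function of the canonical modification `U^{φ_J}` is `φ(z) J`, and `U^{φ_J}` is
coisometric, whichever functional model realization it is built from. Both implications rest on
these two facts.

*Coisometry.* On the vectors `W* k_φ(·, w) y ⊕ y`, which span a dense subspace of `𝒟_φ ⊕ Y`, the
adjoint of a functional model colligation takes the values `k_φ(·, w) y ⊕ φ(w)* y`, so the formula
for `k_φ` says that it is isometric there (`FunctionalModel.norm_adjointOp_eq`). As it is a
contraction, it maps the complement `𝒟_φᗮ` into the complement of the image of `𝒟_φ ⊕ Y`, and only
its defect on `𝒟_φᗮ` is left to be filled. The analysis of contractive completions of an operator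
matrix (`norm_defectOp_rowFactor_sq`) shows that `ξ` is a contraction and that
`(I - ξ* ξ)^{1/2} Δ` is exactly this defect, while `(B^{φ_J})*` is `B*` with the component
`(I - ξ* ξ)^{1/2} Δ` added (`FunctionalModel.BJadjoint_apply`). Hence
`FunctionalModel.canonical_isCoisometric`.

*From coinciding multipliers to coinciding colligations.* If `β φ(z) = ψ(z) α`, then `f ↦ β f` is a
unitary operator from `H(k_φ)` to `H(k_ψ)` that intertwines the pairs `(C, A)`, since these are
given by formulas that do not involve the choice of a realization (`exists_intertwinesOutput`). For
a coisometric colligation the norm of `B* x + D* y` is determined by `x`, `y` and `(C, A)`.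
Therefore the operators `(B* D*)` of the two canonical modifications differ by a unitary operator
between the closures of their ranges, and this one extends to the whole input spaces after one of
them has been enlarged (`Colligation.IntertwinesOutput.exists_augment`). The operator `α` also
identifies the null spaces, which gives the equality of dimensions.

*From coinciding colligations to coinciding multipliers.* A unitary coincidence intertwines the
transfer functions, so `β φ(z) J = ψ(z) J' Ω`. Compressing `Ω` to the complements of the null
spaces gives a contraction with a contractive inverse, that is, a unitary operator intertwining `φ`
and `ψ` there (`exists_orthogonal_equiv`). With a unitary operator between the null spaces, which
have equal dimension, it makes up `α` (`coincide_of_unitarilyCoincident`).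
-/

open scoped InnerProductSpace ComplexConjugate

noncomputable section

namespace DruryArvesonSchur

/-! ### Maps between closures of ranges -/

section HilbertSpace

variable {E F G : Type*} [AddCommGroup E] [Module ℂ E]
  [NormedAddCommGroup F] [InnerProductSpace ℂ F]
  [NormedAddCommGroup G] [InnerProductSpace ℂ G] [CompleteSpace G]

instance [CompleteSpace F] (S : E →ₗ[ℂ] F) : CompleteSpace (rangeClosure S) :=
  (Submodule.isClosed_topologicalClosure _).completeSpace_coe

lemma mem_rangeClosure (S : E →ₗ[ℂ] F) (x : E) : S x ∈ rangeClosure S :=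
  Submodule.le_topologicalClosure _ ⟨x, rfl⟩

@[simp]
lemma coe_toRangeClosure (S : E →ₗ[ℂ] F) (x : E) : (toRangeClosure S x : F) = S x := rfl

/-- To prove a closed property on the closure of the range, it suffices to check the range. -/
lemma rangeClosure_induction {S : E →ₗ[ℂ] F} {p : rangeClosure S → Prop}
    (hp : IsClosed {x | p x}) (h : ∀ x, p (toRangeClosure S x)) (x : rangeClosure S) : p x :=
  (denseRange_toRangeClosure S).induction_on x hp h

lemma norm_extendAlong_le {S : E →ₗ[ℂ] F} {T : E →ₗ[ℂ] G} (h : ∀ x, ‖T x‖ ≤ ‖S x‖)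
    (x : rangeClosure S) : ‖extendAlong S T x‖ ≤ ‖x‖ := by
  have := LinearMap.norm_extendOfNorm_apply_le (f := T) (e := toRangeClosure S)
    (denseRange_toRangeClosure S) 1 (fun x => by simpa using h x) x
  simpa [extendAlong] using this

/-- Two operators with the same domain whose values have the same norms differ by a unitary
operator between the closures of their ranges. -/
lemma exists_rangeClosure_equiv [CompleteSpace F] (S : E →ₗ[ℂ] F) (T : E →ₗ[ℂ] G)
    (h : ∀ x, ‖S x‖ = ‖T x‖) :
    ∃ ω : rangeClosure S ≃ₗᵢ[ℂ] rangeClosure T,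
      ∀ x, ω (toRangeClosure S x) = toRangeClosure T x := by
  have hST : ∃ c, ∀ x, ‖toRangeClosure T x‖ ≤ c * ‖S x‖ := ⟨1, fun x => by simp [h]⟩
  have hTS : ∃ c, ∀ x, ‖toRangeClosure S x‖ ≤ c * ‖T x‖ := ⟨1, fun x => by simp [h]⟩
  let f := extendAlong S (toRangeClosure T)
  let g := extendAlong T (toRangeClosure S)
  have hf : ∀ x, f (toRangeClosure S x) = toRangeClosure T x := extendAlong_apply hST
  have hg : ∀ x, g (toRangeClosure T x) = toRangeClosure S x := extendAlong_apply hTS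
  refine ⟨{ toLinearEquiv := .ofLinearMap f.toLinearMap g.toLinearMap ?_ ?_, norm_map' := ?_ },
    fun x => hf x⟩
  · ext1 x
    refine rangeClosure_induction (p := fun x => f (g x) = x)
      (isClosed_eq (by fun_prop) (by fun_prop)) (fun x => ?_) x
    rw [hg, hf]
  · ext1 x
    refine rangeClosure_induction (p := fun x => g (f x) = x)
      (isClosed_eq (by fun_prop) (by fun_prop)) (fun x => ?_) x
    rw [hf, hg]
  · intro x
    refine rangeClosure_induction (p := fun x => ‖f x‖ = ‖x‖)
      (isClosed_eq (by fun_prop) (by fun_prop)) (fun x => ?_) x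
    rw [hf]
    exact (h x).symm

end HilbertSpace

/-! ### Defect operators of contractions -/

section Defect

variable {K L : Type*} [NormedAddCommGroup K] [InnerProductSpace ℂ K] [CompleteSpace K]
  [NormedAddCommGroup L] [InnerProductSpace ℂ L] [CompleteSpace L]

lemma defectOp_nonneg (T : K →L[ℂ] L) : 0 ≤ defectOp T := CFC.sqrt_nonneg _

@[simp]
lemma adjoint_defectOp (T : K →L[ℂ] L) : (defectOp T).adjoint = defectOp T :=
  (IsSelfAdjoint.of_nonneg (defectOp_nonneg T)).adjoint_eq

lemma inner_defectOp_left (T : K →L[ℂ] L) (x y : K) :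
    ⟪defectOp T x, y⟫_ℂ = ⟪x, defectOp T y⟫_ℂ := by
  rw [← ContinuousLinearMap.adjoint_inner_right, adjoint_defectOp]

lemma norm_adjoint_apply_le {T : K →L[ℂ] L} (hT : ∀ x, ‖T x‖ ≤ ‖x‖) (y : L) :
    ‖T.adjoint y‖ ≤ ‖y‖ := by
  have h : ‖T.adjoint‖ ≤ 1 := by
    rw [LinearIsometryEquiv.norm_map]
    exact T.opNorm_le_bound zero_le_one (by simpa using hT)
  simpa using T.adjoint.le_of_opNorm_le h y

lemma defectOp_mul_self {T : K →L[ℂ] L} (hT : ∀ x, ‖T x‖ ≤ ‖x‖) :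
    defectOp T * defectOp T = 1 - T.adjoint ∘L T := by
  refine CFC.sqrt_mul_sqrt_self _ ?_
  rw [ContinuousLinearMap.nonneg_iff_isPositive, ContinuousLinearMap.isPositive_def']
  refine ⟨?_, fun x => ?_⟩
  · rw [ContinuousLinearMap.isSelfAdjoint_iff', map_sub, ContinuousLinearMap.adjoint_comp,
      ContinuousLinearMap.adjoint_adjoint, ContinuousLinearMap.adjoint_one]
  · rw [ContinuousLinearMap.reApplyInnerSelf_apply]
    simp only [sub_apply, one_apply_eq_self,
      ContinuousLinearMap.comp_apply, inner_sub_left, ContinuousLinearMap.adjoint_inner_left,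
      map_sub, inner_self_eq_norm_sq]
    have := pow_le_pow_left₀ (norm_nonneg _) (hT x) 2
    linarith

lemma defectOp_defectOp_apply {T : K →L[ℂ] L} (hT : ∀ x, ‖T x‖ ≤ ‖x‖) (x : K) :
    defectOp T (defectOp T x) = x - T.adjoint (T x) :=
  DFunLike.congr_fun (defectOp_mul_self hT) x

lemma norm_defectOp_sq {T : K →L[ℂ] L} (hT : ∀ x, ‖T x‖ ≤ ‖x‖) (x : K) :
    ‖defectOp T x‖ ^ 2 = ‖x‖ ^ 2 - ‖T x‖ ^ 2 := by
  rw [← inner_self_eq_norm_sq (𝕜 := ℂ), inner_defectOp_left, defectOp_defectOp_apply hT,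
    inner_sub_right, ContinuousLinearMap.adjoint_inner_right, map_sub, inner_self_eq_norm_sq,
    inner_self_eq_norm_sq]

/-- Square roots of positive operators inherit intertwining relations. The difference
`Q = S' T - T S` satisfies `S' Q = -Q S`, so that `Q* Q S` is both positive (a product of commuting
positive operators) and negative, which forces `Q = 0`. -/
lemma intertwine_of_intertwine_sq {S : K →L[ℂ] K} {S' : L →L[ℂ] L} {T : K →L[ℂ] L}
    (hS : 0 ≤ S) (hS' : 0 ≤ S') (h : S' ∘L S' ∘L T = T ∘L S ∘L S) : S' ∘L T = T ∘L S := by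
  set Q : K →L[ℂ] L := S' ∘L T - T ∘L S with hQ
  have hSa : S.adjoint = S := (IsSelfAdjoint.of_nonneg hS).adjoint_eq
  have hSa' : S'.adjoint = S' := (IsSelfAdjoint.of_nonneg hS').adjoint_eq
  have h1 : S' ∘L Q = -(Q ∘L S) := by
    rw [hQ, ContinuousLinearMap.comp_sub, h, ContinuousLinearMap.sub_comp]
    simp [ContinuousLinearMap.comp_assoc]
  have hpos : 0 ≤ Q.adjoint ∘L Q := by
    rw [ContinuousLinearMap.nonneg_iff_isPositive]
    exact ContinuousLinearMap.isPositive_adjoint_comp_self Q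
  have hneg : 0 ≤ -((Q.adjoint ∘L Q) * S) := by
    have : -((Q.adjoint ∘L Q) * S) = Q.adjoint ∘L S' ∘L Q := by
      rw [h1, ContinuousLinearMap.comp_neg]
      rfl
    rw [this, ContinuousLinearMap.nonneg_iff_isPositive]
    rw [ContinuousLinearMap.nonneg_iff_isPositive] at hS'
    exact hS'.adjoint_conj Q
  have hcomm : Commute (Q.adjoint ∘L Q) S := by
    have h2 := (IsSelfAdjoint.of_nonneg hneg).star_eq
    rw [star_neg, neg_inj, star_mul, (IsSelfAdjoint.of_nonneg hS).star_eq,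
      (IsSelfAdjoint.of_nonneg hpos).star_eq] at h2
    exact h2.symm
  have hzero : (Q.adjoint ∘L Q) * S = 0 :=
    le_antisymm (neg_nonneg.1 hneg) (hcomm.mul_nonneg hpos hS)
  have hQS : Q ∘L S = 0 := by
    ext x
    have := DFunLike.congr_fun hzero x
    rw [zero_apply, ← norm_eq_zero, ← sq_eq_zero_iff,
      ← inner_self_eq_norm_sq (𝕜 := ℂ), ContinuousLinearMap.comp_apply,
      ← ContinuousLinearMap.adjoint_inner_left]
    change Q.adjoint (Q (S x)) = 0 at this
    simp [this]
  have hSQ : S ∘L Q.adjoint = 0 := by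
    have := congrArg ContinuousLinearMap.adjoint hQS
    rwa [ContinuousLinearMap.adjoint_comp, hSa, map_zero] at this
  have hQS' : Q.adjoint ∘L S' = 0 := by
    rw [hQS, neg_zero] at h1
    have := congrArg ContinuousLinearMap.adjoint h1
    rwa [ContinuousLinearMap.adjoint_comp, hSa', map_zero] at this
  have hQQQ : ∀ y, Q.adjoint (Q (Q.adjoint y)) = 0 := by
    intro y
    have e1 : Q.adjoint (S' (T (Q.adjoint y))) = 0 := DFunLike.congr_fun hQS' _
    have e2 : S (Q.adjoint y) = 0 := DFunLike.congr_fun hSQ _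
    have e3 : Q (Q.adjoint y) = S' (T (Q.adjoint y)) - T (S (Q.adjoint y)) := rfl
    rw [e3, e2, map_zero, sub_zero, e1]
  have hQQ : ∀ y, Q (Q.adjoint y) = 0 := fun y => by
    rw [← norm_eq_zero, ← sq_eq_zero_iff, ← inner_self_eq_norm_sq (𝕜 := ℂ),
      ← ContinuousLinearMap.adjoint_inner_left, hQQQ, inner_zero_left, map_zero]
  have hQ0 : Q.adjoint = 0 := by
    ext y
    rw [zero_apply, ← norm_eq_zero, ← sq_eq_zero_iff,
      ← inner_self_eq_norm_sq (𝕜 := ℂ), ContinuousLinearMap.adjoint_inner_left, hQQ,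
      inner_zero_right, map_zero]
  rw [← sub_eq_zero, ← hQ, ← ContinuousLinearMap.adjoint_adjoint Q, hQ0, map_zero]

/-- The defect operators of a contraction and of its adjoint are intertwined:
`(I - T T*)^{1/2} T = T (I - T* T)^{1/2}`. -/
lemma defectOp_adjoint_apply {T : K →L[ℂ] L} (hT : ∀ x, ‖T x‖ ≤ ‖x‖) (x : K) :
    defectOp T.adjoint (T x) = T (defectOp T x) := by
  refine DFunLike.congr_fun (f := defectOp T.adjoint ∘L T) (g := T ∘L defectOp T)
    (intertwine_of_intertwine_sq (defectOp_nonneg T) (defectOp_nonneg _) ?_) x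
  ext x
  simp [defectOp_defectOp_apply hT, defectOp_defectOp_apply (norm_adjoint_apply_le hT)]

lemma adjoint_defectOp_adjoint_apply {T : K →L[ℂ] L} (hT : ∀ x, ‖T x‖ ≤ ‖x‖) (y : L) :
    T.adjoint (defectOp T.adjoint y) = defectOp T (T.adjoint y) := by
  have := defectOp_adjoint_apply (norm_adjoint_apply_le hT) y
  rw [ContinuousLinearMap.adjoint_adjoint] at this
  exact this.symm

end Defect

/-! ### Hilbert space dimension -/

section Dimension

open Cardinal

lemma exists_hilbertDim_eq (E : Type*) [NormedAddCommGroup E] [InnerProductSpace ℂ E]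
    [CompleteSpace E] : ∃ s : Set E, Orthonormal ℂ ((↑) : s → E) ∧
      (Submodule.span ℂ s).topologicalClosure = ⊤ ∧ #s = hilbertDim E := by
  refine csInf_mem (s := {κ | ∃ s : Set E, Orthonormal ℂ ((↑) : s → E) ∧
    (Submodule.span ℂ s).topologicalClosure = ⊤ ∧ #s = κ}) ?_
  obtain ⟨w, b, hb⟩ := exists_hilbertBasis ℂ E
  refine ⟨#w, w, hb ▸ b.orthonormal, ?_, rfl⟩
  have := b.dense_span
  rwa [hb, Subtype.range_coe] at this

lemma lift_hilbertDim_le {E : Type u} {F : Type v} [NormedAddCommGroup E] [InnerProductSpace ℂ E]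
    [CompleteSpace E] [NormedAddCommGroup F] [InnerProductSpace ℂ F] (e : E ≃ₗᵢ[ℂ] F) :
    lift.{u} (hilbertDim F) ≤ lift.{v} (hilbertDim E) := by
  obtain ⟨s, hs, hs', hc⟩ := exists_hilbertDim_eq E
  have key : hilbertDim F ≤ #(e '' s) := by
    refine csInf_le' ⟨e '' s, ?_, ?_, rfl⟩
    · have h := (hs.comp_linearIsometryEquiv e).comp _ (e.toEquiv.image s).symm.injective
      convert! h using 1
      ext x
      obtain ⟨x, y, hy, rfl⟩ := x
      have : (e.toEquiv.image s).symm ⟨e y, y, hy, rfl⟩ = ⟨y, hy⟩ := by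
        rw [Equiv.symm_apply_eq]
        rfl
      exact (congrArg (fun t : s => e t) this).symm
    · have h := hs'
      rw [← Submodule.dense_iff_topologicalClosure_eq_top] at h ⊢
      have h2 : (Submodule.span ℂ (e '' s) : Set F) = e '' Submodule.span ℂ s := by
        have := Submodule.map_span e.toLinearEquiv.toLinearMap s
        exact (congrArg (fun p : Submodule ℂ F => (p : Set F)) this).symm
      rw [h2]
      exact e.surjective.denseRange.dense_image e.continuous h
  rw [← hc]
  exact (lift_le.2 key).trans_eq (Cardinal.mk_image_eq_lift _ _ e.injective)

lemma lift_hilbertDim_eq {E : Type u} {F : Type v} [NormedAddCommGroup E] [InnerProductSpace ℂ E]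
    [CompleteSpace E] [NormedAddCommGroup F] [InnerProductSpace ℂ F] [CompleteSpace F]
    (e : E ≃ₗᵢ[ℂ] F) : lift.{v} (hilbertDim E) = lift.{u} (hilbertDim F) :=
  le_antisymm (lift_hilbertDim_le e.symm) (lift_hilbertDim_le e)

lemma exists_equiv_of_hilbertDim_eq {E : Type u} {F : Type v} [NormedAddCommGroup E]
    [InnerProductSpace ℂ E] [CompleteSpace E] [NormedAddCommGroup F] [InnerProductSpace ℂ F]
    [CompleteSpace F] (h : lift.{v} (hilbertDim E) = lift.{u} (hilbertDim F)) :
    Nonempty (E ≃ₗᵢ[ℂ] F) := by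
  obtain ⟨s, hs, hs', hsc⟩ := exists_hilbertDim_eq E
  obtain ⟨t, ht, ht', htc⟩ := exists_hilbertDim_eq F
  rw [← hsc, ← htc, Cardinal.lift_mk_eq'] at h
  obtain ⟨σ⟩ := h
  let b : HilbertBasis s ℂ E := .mk hs (by rw [Subtype.range_coe, hs'])
  let b' : HilbertBasis s ℂ F := .mk (ht.comp σ σ.injective)
    (by rw [σ.surjective.range_comp, Subtype.range_coe, ht'])
  exact ⟨b.repr.trans b'.repr.symm⟩

end Dimension

/-! ### Unitary operators between separable Hilbert spaces -/

section Separable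

open TopologicalSpace

/-- A separable Hilbert space has a Hilbert basis indexed by a set of natural numbers. -/
lemma exists_hilbertBasis_nat (E : Type*) [NormedAddCommGroup E] [InnerProductSpace ℂ E]
    [CompleteSpace E] [SeparableSpace E] :
    ∃ s : Set ℕ, Nonempty (HilbertBasis s ℂ E) := by
  obtain ⟨w, b, hb⟩ := exists_hilbertBasis ℂ E
  -- distinct basis vectors are at distance `√2`
  have hw : Countable w := by
    refine Pairwise.countable_of_isOpen_disjoint (s := fun i => Metric.ball (b i) (1 / 2)) ?_
      (fun i => Metric.isOpen_ball) (fun i => Metric.nonempty_ball.2 (by norm_num))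
    intro i j hij
    refine Metric.ball_disjoint_ball ?_
    have h : ‖b i - b j‖ ^ 2 = 2 := by
      rw [norm_sub_sq (𝕜 := ℂ), b.orthonormal.2 hij, b.orthonormal.1, b.orthonormal.1]
      norm_num
    rw [dist_eq_norm]
    nlinarith [norm_nonneg (b i - b j)]
  obtain ⟨f, hf⟩ := exists_injective_nat w
  let σ := Equiv.ofInjective f hf
  exact ⟨Set.range f, ⟨.mk (b.orthonormal.comp σ.symm σ.symm.injective)
    (by rw [σ.symm.surjective.range_comp, b.dense_span])⟩⟩

/-- Of two separable Hilbert spaces, one embeds isometrically into the other. -/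
lemma exists_isometry_total (E F : Type*) [NormedAddCommGroup E] [InnerProductSpace ℂ E]
    [CompleteSpace E] [SeparableSpace E] [NormedAddCommGroup F] [InnerProductSpace ℂ F]
    [CompleteSpace F] [SeparableSpace F] : Nonempty (E →ₗᵢ[ℂ] F) ∨ Nonempty (F →ₗᵢ[ℂ] E) := by
  obtain ⟨s, ⟨b⟩⟩ := exists_hilbertBasis_nat E
  obtain ⟨t, ⟨b'⟩⟩ := exists_hilbertBasis_nat F
  rcases Function.Embedding.total s t with ⟨⟨σ⟩⟩ | ⟨⟨σ⟩⟩
  · exact .inl ⟨(b'.orthonormal.comp σ σ.injective).orthogonalFamily.linearIsometry.comp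
      b.repr.toLinearIsometry⟩
  · exact .inr ⟨(b.orthonormal.comp σ σ.injective).orthogonalFamily.linearIsometry.comp
      b'.repr.toLinearIsometry⟩

variable {E F : Type*} [NormedAddCommGroup E] [InnerProductSpace ℂ E] [CompleteSpace E]
  [NormedAddCommGroup F] [InnerProductSpace ℂ F]

/-- An isometry between Hilbert spaces becomes unitary after adding to its domain a copy of the
complement of its range. For a separable codomain that copy can be taken in `Type`. -/
lemma exists_unitary_extension [CompleteSpace F] [SeparableSpace F] (V : E →ₗᵢ[ℂ] F) :
    ∃ (H : Type) (_ : NormedAddCommGroup H) (_ : InnerProductSpace ℂ H) (_ : CompleteSpace H)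
      (_ : SeparableSpace H) (Ω : WithLp 2 (E × H) ≃ₗᵢ[ℂ] F),
      ∀ x, Ω (WithLp.toLp 2 (x, 0)) = V x := by
  let R : Submodule ℂ F := LinearMap.range V.toLinearMap
  have hR : IsClosed (R : Set F) := V.isometry.isClosedEmbedding.isClosed_range
  have : CompleteSpace R := hR.completeSpace_coe
  obtain ⟨s, ⟨b⟩⟩ := exists_hilbertBasis_nat Rᗮ
  let H := lp (fun _ : s => ℂ) 2
  have hsep : SeparableSpace H :=
    b.repr.toHomeomorph.surjective.denseRange.separableSpace b.repr.continuous
  refine ⟨H, inferInstance, inferInstance, inferInstance, hsep, ?_⟩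
  let f : WithLp 2 (E × H) →ₗ[ℂ] F :=
    V.toLinearMap ∘ₗ (WithLp.fstL 2 ℂ E H).toLinearMap
      + Rᗮ.subtype ∘ₗ b.repr.symm.toLinearEquiv.toLinearMap ∘ₗ
        (WithLp.sndL 2 ℂ E H).toLinearMap
  have hf : ∀ x, f x = V x.fst + b.repr.symm x.snd := fun x => rfl
  have hnorm : ∀ x, ‖f x‖ = ‖x‖ := by
    intro x
    refine (sq_eq_sq₀ (norm_nonneg _) (norm_nonneg _)).1 ?_
    have h0 : ⟪V x.fst, (b.repr.symm x.snd : F)⟫_ℂ = 0 :=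
      (b.repr.symm x.snd).2 _ ⟨x.fst, rfl⟩
    have h1 : ‖(b.repr.symm x.snd : F)‖ = ‖x.snd‖ := b.repr.symm.norm_map x.snd
    rw [hf, norm_add_sq (𝕜 := ℂ), h0, WithLp.prod_norm_sq_eq_of_L2, V.norm_map, h1]
    simp
  have hsurj : Function.Surjective f := by
    intro y
    obtain ⟨x, hx⟩ := R.starProjection_apply_mem y
    refine ⟨WithLp.toLp 2 (x, b.repr (Rᗮ.orthogonalProjectionOnto y)), ?_⟩
    change V x + b.repr.symm (b.repr (Rᗮ.orthogonalProjectionOnto y)) = y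
    rw [b.repr.symm_apply_apply]
    change V x + Rᗮ.starProjection y = y
    rw [show V x = R.starProjection y from hx]
    exact R.starProjection_add_starProjection_orthogonal y
  refine ⟨.ofSurjective ⟨f, hnorm⟩ hsurj, fun x => ?_⟩
  change f _ = _
  rw [hf]
  simp

variable {D : Type*} [AddCommGroup D] [Module ℂ D]

/-- A unitary operator between the closures of the ranges of `S` and `T` with `ω S = T` extends to
an isometry when the complement of the first range embeds into that of the second. -/
lemma exists_isometry_extension {S : D →ₗ[ℂ] E} {T : D →ₗ[ℂ] F}
    (ω : rangeClosure S ≃ₗᵢ[ℂ] rangeClosure T)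
    (hω : ∀ x, ω (toRangeClosure S x) = toRangeClosure T x)
    (j : (rangeClosure S)ᗮ →ₗᵢ[ℂ] (rangeClosure T)ᗮ) : ∃ V : E →ₗᵢ[ℂ] F, ∀ x, V (S x) = T x := by
  let P := rangeClosure S
  let f : E →ₗ[ℂ] F :=
    (rangeClosure T).subtype ∘ₗ ω.toLinearEquiv.toLinearMap ∘ₗ
        P.orthogonalProjectionOnto.toLinearMap
      + (rangeClosure T)ᗮ.subtype ∘ₗ j.toLinearMap ∘ₗ Pᗮ.orthogonalProjectionOnto.toLinearMap
  have hf : ∀ x, f x = ω (P.orthogonalProjectionOnto x) + j (Pᗮ.orthogonalProjectionOnto x) :=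
    fun x => rfl
  refine ⟨⟨f, fun x => (sq_eq_sq₀ (norm_nonneg _) (norm_nonneg _)).1 ?_⟩, fun x => ?_⟩
  · have h0 : ⟪(ω (P.orthogonalProjectionOnto x) : F), (j (Pᗮ.orthogonalProjectionOnto x) : F)⟫_ℂ
      = 0 := (j (Pᗮ.orthogonalProjectionOnto x)).2 _ (ω (P.orthogonalProjectionOnto x)).2
    have h1 : ‖(ω (P.orthogonalProjectionOnto x) : F)‖ = _ := ω.norm_map _
    have h2 : ‖(j (Pᗮ.orthogonalProjectionOnto x) : F)‖ = _ := j.norm_map _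
    rw [hf, norm_add_sq (𝕜 := ℂ), h0, P.norm_sq_eq_add_norm_sq_projection x, h1, h2]
    simp only [map_zero, mul_zero, add_zero]
  · change f (S x) = T x
    have h1 : P.orthogonalProjectionOnto (S x) = toRangeClosure S x :=
      P.orthogonalProjectionOnto_mem_subspace_eq_self (toRangeClosure S x)
    have h2 : Pᗮ.orthogonalProjectionOnto (S x) = 0 :=
      P.orthogonalProjectionOnto_orthogonal_apply_eq_zero (mem_rangeClosure S x)
    rw [hf, h1, h2, hω]
    simp

/-- If two operators from the same domain into separable Hilbert spaces take values of equal norm,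
then a unitary operator carries the one to the other, after one of the two codomains has been
enlarged to make the complements of the ranges equidimensional. -/
lemma exists_unitary_of_norm_eq [CompleteSpace F] [SeparableSpace E] [SeparableSpace F]
    (S : D →ₗ[ℂ] E) (T : D →ₗ[ℂ] F) (h : ∀ x, ‖S x‖ = ‖T x‖) :
    ∃ (H : Type) (_ : NormedAddCommGroup H) (_ : InnerProductSpace ℂ H) (_ : CompleteSpace H)
      (_ : SeparableSpace H),
      (∃ Ω : WithLp 2 (E × H) ≃ₗᵢ[ℂ] F, ∀ x, Ω (WithLp.toLp 2 (S x, 0)) = T x) ∨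
      (∃ Ω : WithLp 2 (F × H) ≃ₗᵢ[ℂ] E, ∀ x, Ω (WithLp.toLp 2 (T x, 0)) = S x) := by
  obtain ⟨ω, hω⟩ := exists_rangeClosure_equiv S T h
  rcases exists_isometry_total (rangeClosure S)ᗮ (rangeClosure T)ᗮ with ⟨⟨j⟩⟩ | ⟨⟨j⟩⟩
  · obtain ⟨V, hV⟩ := exists_isometry_extension ω hω j
    obtain ⟨H, i1, i2, i3, i4, Ω, hΩ⟩ := exists_unitary_extension V
    exact ⟨H, i1, i2, i3, i4, .inl ⟨Ω, fun x => by rw [hΩ, hV]⟩⟩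
  · obtain ⟨V, hV⟩ := exists_isometry_extension ω.symm
      (fun x => by rw [← hω, LinearIsometryEquiv.symm_apply_apply]) j
    obtain ⟨H, i1, i2, i3, i4, Ω, hΩ⟩ := exists_unitary_extension V
    exact ⟨H, i1, i2, i3, i4, .inr ⟨Ω, fun x => by rw [hΩ, hV]⟩⟩

end Separable

/-! ### Gram matrices and reproducing kernels -/

section Isometries

variable {K L : Type*} [NormedAddCommGroup K] [InnerProductSpace ℂ K] [CompleteSpace K]
  [NormedAddCommGroup L] [InnerProductSpace ℂ L] [CompleteSpace L]

/-- A contraction preserves inner products with the vectors whose norm it preserves. -/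
lemma inner_map_of_norm_eq {T : K →L[ℂ] L} (hT : ∀ x, ‖T x‖ ≤ ‖x‖) {g : K} (hg : ‖T g‖ = ‖g‖)
    (x : K) : ⟪T x, T g⟫_ℂ = ⟪x, g⟫_ℂ := by
  have h : T.adjoint (T g) - g = 0 := by
    rw [← norm_eq_zero, ← sq_eq_zero_iff]
    refine le_antisymm ?_ (sq_nonneg _)
    have h1 := pow_le_pow_left₀ (norm_nonneg _) (norm_adjoint_apply_le hT (T g)) 2
    rw [norm_sub_sq (𝕜 := ℂ), ContinuousLinearMap.adjoint_inner_left, inner_self_eq_norm_sq]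
    rw [hg] at h1 ⊢
    linarith
  rw [← ContinuousLinearMap.adjoint_inner_right, sub_eq_zero.1 h]

end Isometries

section Finsupp

variable {K L X V : Type*} [NormedAddCommGroup K] [InnerProductSpace ℂ K]
  [NormedAddCommGroup L] [InnerProductSpace ℂ L] [AddCommGroup V] [Module ℂ V]

lemma inner_finsupp_eq {S : (X →₀ V) →ₗ[ℂ] K} {T : (X →₀ V) →ₗ[ℂ] L}
    (h : ∀ x y v w, ⟪S (.single x v), S (.single y w)⟫_ℂ = ⟪T (.single x v), T (.single y w)⟫_ℂ)
    (f g : X →₀ V) : ⟪S f, S g⟫_ℂ = ⟪T f, T g⟫_ℂ := by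
  induction f using Finsupp.induction_linear with
  | zero => simp
  | add f f' hf hf' => simp only [map_add, inner_add_left, hf, hf']
  | single x v =>
    induction g using Finsupp.induction_linear with
    | zero => simp
    | add f f' hf hf' => simp only [map_add, inner_add_right, hf, hf']
    | single y w => exact h x y v w

lemma norm_finsupp_eq {S : (X →₀ V) →ₗ[ℂ] K} {T : (X →₀ V) →ₗ[ℂ] L}
    (h : ∀ x y v w, ⟪S (.single x v), S (.single y w)⟫_ℂ = ⟪T (.single x v), T (.single y w)⟫_ℂ)
    (f : X →₀ V) : ‖S f‖ = ‖T f‖ := by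
  rw [← sq_eq_sq₀ (norm_nonneg _) (norm_nonneg _), ← inner_self_eq_norm_sq (𝕜 := ℂ),
    ← inner_self_eq_norm_sq (𝕜 := ℂ), inner_finsupp_eq h]

end Finsupp

section Transport

variable {X V W : Type*} [NormedAddCommGroup V] [InnerProductSpace ℂ V] [CompleteSpace V]
  [NormedAddCommGroup W] [InnerProductSpace ℂ W] [CompleteSpace W]

/-- The combinations `∑ k(·, x) v_x` of kernel functions, as a linear map on finitely supported
families. -/
def kernelSum (H : Type*) {X V : Type*} [NormedAddCommGroup V] [InnerProductSpace ℂ V]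
    [CompleteSpace V] [NormedAddCommGroup H] [InnerProductSpace ℂ H] [CompleteSpace H]
    [RKHS ℂ H X V] : (X →₀ V) →ₗ[ℂ] H :=
  Finsupp.lsum ℂ fun x => (RKHS.kerFun H x).toLinearMap

variable {H H' : Type*} [NormedAddCommGroup H] [InnerProductSpace ℂ H] [CompleteSpace H]
  [NormedAddCommGroup H'] [InnerProductSpace ℂ H'] [CompleteSpace H']
  [RKHS ℂ H X V] [RKHS ℂ H' X W]

@[simp]
lemma kernelSum_single (x : X) (v : V) : kernelSum H (.single x v) = RKHS.kerFun H x v := by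
  simp [kernelSum]

variable (H) in
lemma rangeClosure_kernelSum : rangeClosure (kernelSum H (X := X) (V := V)) = ⊤ := by
  rw [eq_top_iff, ← RKHS.kerFun_dense H]
  refine Submodule.topologicalClosure_mono (Submodule.span_le.2 ?_)
  rintro _ ⟨x, v, rfl⟩
  exact ⟨.single x v, kernelSum_single x v⟩

/-- A unitary operator intertwining the kernels of two reproducing kernel Hilbert spaces acts
pointwise as a unitary operator between the spaces. -/
lemma exists_rkhs_equiv (β : V ≃ₗᵢ[ℂ] W)
    (h : ∀ x y v, β (RKHS.kernel H x y v) = RKHS.kernel H' x y (β v)) :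
    ∃ Λ : H ≃ₗᵢ[ℂ] H', ∀ f x, Λ f x = β (f x) := by
  let S := kernelSum H (X := X) (V := V)
  let T : (X →₀ V) →ₗ[ℂ] H' :=
    kernelSum H' ∘ₗ Finsupp.mapRange.linearMap β.toLinearEquiv.toLinearMap
  have hT : ∀ x v, T (.single x v) = RKHS.kerFun H' x (β v) := fun x v => by
    simp [T]
  have hTtop : rangeClosure T = ⊤ := by
    rw [eq_top_iff, ← RKHS.kerFun_dense H']
    refine Submodule.topologicalClosure_mono (Submodule.span_le.2 ?_)
    rintro _ ⟨x, w, rfl⟩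
    exact ⟨.single x (β.symm w), by simp [hT]⟩
  obtain ⟨ω, hω⟩ := exists_rangeClosure_equiv S T <| norm_finsupp_eq fun x y v w => by
    rw [hT, hT, kernelSum_single, kernelSum_single, ← RKHS.kernel_inner, ← RKHS.kernel_inner, ← h,
      LinearIsometryEquiv.inner_map_map]
  let Λ : H ≃ₗᵢ[ℂ] H' := ((LinearIsometryEquiv.ofTop H _ (rangeClosure_kernelSum H)).symm.trans
    ω).trans (LinearIsometryEquiv.ofTop H' _ hTtop)
  have hΛ : ∀ x v, Λ (RKHS.kerFun H x v) = RKHS.kerFun H' x (β v) := by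
    intro x v
    rw [← hT, ← kernelSum_single]
    exact congrArg Subtype.val (hω (.single x v))
  refine ⟨Λ, fun f x => ext_inner_left ℂ fun w => ?_⟩
  obtain ⟨v, rfl⟩ := β.surjective w
  rw [← RKHS.kerFun_inner, ← hΛ, LinearIsometryEquiv.inner_map_map,
    LinearIsometryEquiv.inner_map_map, RKHS.kerFun_inner]

end Transport

/-! ### The row operator and the adjoint of a colligation -/

section RowOperator

variable {d : ℕ} {K : Type*} [NormedAddCommGroup K] [InnerProductSpace ℂ K]

lemma row_apply (z : Ball d) (x : PiLp 2 fun _ : Fin d => K) :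
    Colligation.row K z x = ∑ j, z.1 j • x j := by
  simp [Colligation.row]

lemma map_row {L : Type*} [NormedAddCommGroup L] [InnerProductSpace ℂ L] (Λ : K ≃ₗᵢ[ℂ] L)
    (z : Ball d) (x : PiLp 2 fun _ : Fin d => K) : Colligation.row L z
      (LinearIsometryEquiv.piLpCongrRight 2 (fun _ : Fin d => Λ) x) =
        Λ (Colligation.row K z x) := by
  simp [row_apply]

variable [CompleteSpace K]

lemma adjoint_row_apply (z : Ball d) (f : K) :
    (Colligation.row K z).adjoint f = WithLp.toLp 2 fun j => conj (z.1 j) • f := by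
  refine ext_inner_right ℂ fun x => ?_
  rw [ContinuousLinearMap.adjoint_inner_left, row_apply, PiLp.inner_apply, inner_sum]
  simp [inner_smul_left, inner_smul_right]

lemma norm_row_le (z : Ball d) : ‖Colligation.row K z‖ ≤ ‖z.1‖ := by
  rw [← LinearIsometryEquiv.norm_map ContinuousLinearMap.adjoint]
  refine ContinuousLinearMap.opNorm_le_bound _ (norm_nonneg _) fun f => ?_
  rw [← sq_le_sq₀ (norm_nonneg _) (by positivity), adjoint_row_apply, PiLp.norm_sq_eq_of_L2,
    mul_pow, EuclideanSpace.norm_sq_eq, Finset.sum_mul]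
  simp [norm_smul, mul_pow]

end RowOperator

section Colligations

variable {d : ℕ} {K U Y : Type*} [NormedAddCommGroup K] [InnerProductSpace ℂ K] [CompleteSpace K]
  [NormedAddCommGroup U] [InnerProductSpace ℂ U]
  [NormedAddCommGroup Y] [InnerProductSpace ℂ Y]

namespace Colligation

lemma isUnit_one_sub (c : Colligation d K U Y) (hc : c.IsContractive) (z : Ball d) :
    IsUnit (1 - row K z ∘L c.A) := by
  have hA : ‖c.A‖ ≤ 1 := c.A.opNorm_le_bound zero_le_one fun x => by
    have := hc x 0
    simp only [map_zero, add_zero, norm_zero] at this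
    rw [one_mul, ← sq_le_sq₀ (norm_nonneg _) (norm_nonneg _)]
    nlinarith [sq_nonneg ‖c.C x‖]
  refine isUnit_one_sub_of_norm_lt_one ?_
  calc _ ≤ ‖row K z‖ * ‖c.A‖ := ContinuousLinearMap.opNorm_comp_le _ _
    _ ≤ ‖z.1‖ * 1 := by gcongr; exact norm_row_le z
    _ < 1 := by rw [mul_one]; exact mem_ball_zero_iff.1 z.2

variable [CompleteSpace U] [CompleteSpace Y]

/-- The adjoint `(A* C*; B* D*) : Kᵈ ⊕ Y → K ⊕ U` of a colligation, as one operator. -/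
def adjointOp (c : Colligation d K U Y) :
    WithLp 2 ((PiLp 2 fun _ : Fin d => K) × Y) →L[ℂ] WithLp 2 (K × U) :=
  (WithLp.prodContinuousLinearEquiv 2 ℂ K U).symm.toContinuousLinearMap ∘L
    (c.A.adjoint ∘L WithLp.fstL 2 ℂ _ Y + c.C.adjoint ∘L WithLp.sndL 2 ℂ _ Y).prod
      (c.B.adjoint ∘L WithLp.fstL 2 ℂ _ Y + c.D.adjoint ∘L WithLp.sndL 2 ℂ _ Y)

lemma adjointOp_apply (c : Colligation d K U Y) (x : PiLp 2 fun _ : Fin d => K) (y : Y) :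
    c.adjointOp (WithLp.toLp 2 (x, y)) =
      WithLp.toLp 2 (c.A.adjoint x + c.C.adjoint y, c.B.adjoint x + c.D.adjoint y) := rfl

lemma norm_adjointOp_le (c : Colligation d K U Y) (hc : c.IsContractive)
    (q : WithLp 2 ((PiLp 2 fun _ : Fin d => K) × Y)) : ‖c.adjointOp q‖ ≤ ‖q‖ := by
  obtain ⟨x, y⟩ := q
  rw [← sq_le_sq₀ (norm_nonneg _) (norm_nonneg _), adjointOp_apply,
    WithLp.prod_norm_sq_eq_of_L2, WithLp.prod_norm_sq_eq_of_L2]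
  set p := c.A.adjoint x + c.C.adjoint y with hp
  set q := c.B.adjoint x + c.D.adjoint y with hq
  change ‖p‖ ^ 2 + ‖q‖ ^ 2 ≤ ‖x‖ ^ 2 + ‖y‖ ^ 2
  have h1 : ‖p‖ ^ 2 + ‖q‖ ^ 2 = RCLike.re ⟪c.A p + c.B q, x⟫_ℂ
      + RCLike.re ⟪c.C p + c.D q, y⟫_ℂ := by
    rw [← inner_self_eq_norm_sq (𝕜 := ℂ), ← inner_self_eq_norm_sq (𝕜 := ℂ)]
    have e1 : ⟪p, c.A.adjoint x + c.C.adjoint y⟫_ℂ = ⟪p, p⟫_ℂ := rfl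
    have e2 : ⟪q, c.B.adjoint x + c.D.adjoint y⟫_ℂ = ⟪q, q⟫_ℂ := rfl
    rw [← e1, ← e2]
    simp only [inner_add_left, inner_add_right, ContinuousLinearMap.adjoint_inner_right, map_add]
    ring
  -- with `p ⊕ q = V* (x ⊕ y)`: the norm of `V (p ⊕ q) - x ⊕ y` is nonnegative
  have h2 := hc p q
  have h3 := norm_sub_sq (𝕜 := ℂ) (c.A p + c.B q) x
  have h4 := norm_sub_sq (𝕜 := ℂ) (c.C p + c.D q) y
  nlinarith [sq_nonneg ‖c.A p + c.B q - x‖, sq_nonneg ‖c.C p + c.D q - y‖]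

end Colligation

end Colligations

/-! ### The Drury–Arveson space and the Gleason problem -/

section DruryArvesonFacts

variable {d : ℕ} {Y : Type*} [NormedAddCommGroup Y] [InnerProductSpace ℂ Y] [CompleteSpace Y]

lemma szego_mul (z w : Ball d) : ⟪w.1, z.1⟫_ℂ * szego z w = szego z w - 1 := by
  rw [szego]
  field_simp [one_sub_inner_ne_zero z w]
  ring

@[simp]
lemma coe_zero_ball : ((0 : Ball d) : EuclideanSpace ℂ (Fin d)) = 0 := rfl

@[simp]
lemma szego_zero_right (z : Ball d) : szego z 0 = 1 := by simp [szego]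

/-- The identity `I - ∑ M_{z_j} M_{z_j}* = ` (projection onto the constants) of the Drury–Arveson
space, evaluated at a point. -/
lemma druryArveson_apply_eq (F : DruryArveson d Y) (z : Ball d) :
    F z = F 0 + ∑ j, z.1 j • ((coordMul Y j).adjoint F) z := by
  refine ext_inner_left ℂ fun y => ?_
  -- dually, `∑ conj (z_j) M_{z_j} k(·, z) y = k(·, z) y - k(·, 0) y`
  have h : RKHS.kerFun (DruryArveson d Y) z y = RKHS.kerFun (DruryArveson d Y) 0 y
      + ∑ j, conj (z.1 j) • coordMul Y j (RKHS.kerFun (DruryArveson d Y) z y) := by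
    have happ : ∀ (s : Finset (Fin d)) (f : Fin d → DruryArveson d Y) (w : Ball d),
        (∑ j ∈ s, f j) w = ∑ j ∈ s, f j w := by
      intro s f w
      rw [← RKHS.adjoint_kerFun, map_sum]
      simp
    refine RKHS.ext fun w => ?_
    rw [RKHS.coe_add, Pi.add_apply, happ]
    simp only [RKHS.coe_smul, Pi.smul_apply, coordMul_apply, RKHS.kerFun_apply,
      kernel_druryArveson]
    have e : ∑ j, conj (z.1 j) • w.1 j • (arvesonKernel d Y w z) y
        = (⟪z.1, w.1⟫_ℂ * szego w z) • y := by
      rw [inner_ball_eq, Finset.sum_mul, Finset.sum_smul]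
      refine Finset.sum_congr rfl fun j _ => ?_
      simp only [arvesonKernel, Matrix.of_apply, FunLike.coe_smul, Pi.smul_apply, smul_smul,
        one_apply_eq_self]
      ring_nf
    rw [e, szego_mul]
    simp [arvesonKernel, sub_smul]
  rw [← RKHS.kerFun_inner, h, inner_add_left, RKHS.kerFun_inner, sum_inner, inner_add_right,
    inner_sum]
  congr 1
  refine Finset.sum_congr rfl fun j _ => ?_
  rw [inner_smul_left, RCLike.conj_conj, ← ContinuousLinearMap.adjoint_inner_right,
    RKHS.kerFun_inner, inner_smul_right]

end DruryArvesonFacts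

/-! ### Functional models on kernel functions -/

section FunctionalModelFacts

variable {d : ℕ} {U Y : Type*}
  [NormedAddCommGroup U] [InnerProductSpace ℂ U] [CompleteSpace U]
  [NormedAddCommGroup Y] [InnerProductSpace ℂ Y] [CompleteSpace Y]
  {φ : SchurMultiplier d U Y}

open Colligation

lemma SchurMultiplier.kerFun_apply (z w : Ball d) (y : Y) :
    RKHS.kerFun φ.DeBrangesRovnyak w y z = szego z w • (y - φ z ((φ w).adjoint y)) := by
  rw [RKHS.kerFun_apply, φ.kernel_deBrangesRovnyak]
  rfl

lemma SchurMultiplier.row_apply_apply (z w : Ball d) (x : φ.Column) :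
    (row φ.DeBrangesRovnyak z x) w = ∑ j, z.1 j • (x j) w := by
  rw [← RKHS.adjoint_kerFun, row_apply, map_sum]
  simp

lemma SchurMultiplier.shiftedKernel_single_eq (w : Ball d) (y : Y) :
    φ.shiftedKernel (.single w y)
      = (row φ.DeBrangesRovnyak w).adjoint (RKHS.kerFun φ.DeBrangesRovnyak w y) := by
  ext j : 1
  rw [shiftedKernel_single, adjoint_row_apply]

/-- The elements of `𝒟_φ` given by finite combinations of its generators. -/
def SchurMultiplier.toDSpace (φ : SchurMultiplier d U Y) : (Ball d →₀ Y) →ₗ[ℂ] φ.DSpace :=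
  toRangeClosure φ.shiftedKernel

@[simp]
lemma SchurMultiplier.coe_toDSpace (x : Ball d →₀ Y) :
    (φ.toDSpace x : φ.Column) = φ.shiftedKernel x := rfl

lemma SchurMultiplier.dSpace_induction {p : φ.DSpace → Prop} (hp : IsClosed {l | p l})
    (h : ∀ x, p (φ.toDSpace x)) (l : φ.DSpace) : p l :=
  rangeClosure_induction hp h l

namespace FunctionalModel

variable (a : FunctionalModel φ)

/-- The backward shift solves the Gleason problem: `f(z) = f(0) + ∑ z_j (A_j f)(z)`. -/
lemma apply_eq (f : φ.DeBrangesRovnyak) (z : Ball d) :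
    f z = f 0 + (row φ.DeBrangesRovnyak z (a.A f)) z := by
  have h : ∀ j, ∃ F : DruryArveson d Y,
    (∀ z, F z = f z) ∧ ∀ z, (a.A f j) z = ((coordMul Y j).adjoint F) z := fun j => a.A_eq f j
  choose F hF hF' using h
  rw [SchurMultiplier.row_apply_apply]
  -- there is one `F` for each `j`, but all of them represent `f`; for `d = 0` there is none
  rcases isEmpty_or_nonempty (Fin d) with hd | ⟨⟨i⟩⟩
  · have : z = 0 := Subtype.ext (PiLp.ext fun j => hd.elim j)
    simp [this]
  · have hFi : ∀ j, F j = F i := fun j => RKHS.ext fun w => by rw [hF, hF]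
    rw [← hF i, ← hF i, druryArveson_apply_eq (F i) z]
    simp only [hF', hFi]

/-- Point evaluations of `H(k_φ)` in terms of the colligation: `f(z) = C (I - Z A)⁻¹ f`. -/
lemma adjoint_kerFun_comp (z : Ball d) :
    (RKHS.kerFun φ.DeBrangesRovnyak z).adjoint ∘L (1 - row φ.DeBrangesRovnyak z ∘L a.A) = a.C := by
  ext f
  have h := a.apply_eq f z
  simp only [ContinuousLinearMap.comp_apply, sub_apply, one_apply_eq_self, map_sub,
    RKHS.adjoint_kerFun]
  rw [a.C_eq, h, add_sub_cancel_right]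

lemma apply_eq_transfer (z : Ball d) (u : U) :
    φ z u = φ 0 u + (row φ.DeBrangesRovnyak z (a.B u)) z := by
  conv_lhs => rw [← a.transfer_eq z]
  have h : a.C ∘L Ring.inverse (1 - row φ.DeBrangesRovnyak z ∘L a.A)
      = (RKHS.kerFun φ.DeBrangesRovnyak z).adjoint := by
    rw [← a.adjoint_kerFun_comp z, ContinuousLinearMap.comp_assoc]
    have := Ring.mul_inverse_cancel _ (a.isUnit_one_sub a.contractive z)
    rw [ContinuousLinearMap.mul_def] at this
    rw [this]
    rfl
  rw [transfer, ← ContinuousLinearMap.comp_assoc, h, a.D_eq]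
  simp

lemma adjoint_C_apply (y : Y) : a.C.adjoint y = RKHS.kerFun φ.DeBrangesRovnyak 0 y := by
  refine ext_inner_right ℂ fun f => ?_
  rw [ContinuousLinearMap.adjoint_inner_left, a.C_eq, RKHS.kerFun_inner]

lemma adjoint_A_shiftedKernel_single (w : Ball d) (y : Y) :
    a.A.adjoint (φ.shiftedKernel (.single w y))
      = RKHS.kerFun φ.DeBrangesRovnyak w y - RKHS.kerFun φ.DeBrangesRovnyak 0 y := by
  refine ext_inner_right ℂ fun f => ?_
  rw [SchurMultiplier.shiftedKernel_single_eq, ContinuousLinearMap.adjoint_inner_left,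
    ContinuousLinearMap.adjoint_inner_left, RKHS.kerFun_inner, inner_sub_left, RKHS.kerFun_inner,
    RKHS.kerFun_inner, ← inner_sub_right, a.apply_eq f w, add_sub_cancel_left]

lemma adjoint_B_shiftedKernel_single (w : Ball d) (y : Y) :
    a.B.adjoint (φ.shiftedKernel (.single w y)) = (φ w).adjoint y - (φ 0).adjoint y := by
  refine ext_inner_right ℂ fun u => ?_
  rw [SchurMultiplier.shiftedKernel_single_eq, ContinuousLinearMap.adjoint_inner_left,
    ContinuousLinearMap.adjoint_inner_left, RKHS.kerFun_inner, inner_sub_left,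
    ContinuousLinearMap.adjoint_inner_left, ContinuousLinearMap.adjoint_inner_left,
    ← inner_sub_right, a.apply_eq_transfer w, add_sub_cancel_left]

/-- The operator `R` is the restriction of `B*`; in particular it is bounded. -/
lemma R_apply (l : φ.DSpace) : φ.R l = a.B.adjoint l := by
  have h : ∀ x, (Finsupp.lsum ℂ fun w => ((φ w).adjoint - (φ 0).adjoint).toLinearMap) x
      = a.B.adjoint (φ.shiftedKernel x) := by
    intro x
    induction x using Finsupp.induction_linear with
    | zero => simp
    | add f g hf hg => simp only [map_add, hf, hg]
    | single w y => simp [adjoint_B_shiftedKernel_single]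
  refine SchurMultiplier.dSpace_induction (p := fun l => φ.R l = a.B.adjoint l)
    (isClosed_eq (by fun_prop) (by fun_prop)) (fun x => ?_) l
  rw [SchurMultiplier.coe_toDSpace, ← h]
  refine extendAlong_apply ⟨‖a.B.adjoint‖, fun x => ?_⟩ x
  rw [h]
  exact ContinuousLinearMap.le_opNorm _ _

/-- The adjoint colligation maps `W* k_φ(·, w) y ⊕ y` to `k_φ(·, w) y ⊕ φ(w)* y`. -/
lemma adjointOp_single (w : Ball d) (y : Y) :
    a.adjointOp (WithLp.toLp 2 (φ.shiftedKernel (.single w y), y))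
      = WithLp.toLp 2 (RKHS.kerFun φ.DeBrangesRovnyak w y, (φ w).adjoint y) := by
  rw [adjointOp_apply, adjoint_A_shiftedKernel_single, adjoint_B_shiftedKernel_single,
    adjoint_C_apply, a.D_eq, sub_add_cancel, sub_add_cancel]

/-- The adjoint colligation is isometric on `𝒟_φ ⊕ Y`, as the formula for the kernel `k_φ` shows on
the vectors `W* k_φ(·, w) y ⊕ y`. -/
lemma norm_adjointOp_eq (l : φ.DSpace) (y : Y) :
    ‖a.adjointOp (WithLp.toLp 2 (l.1, y))‖ = ‖WithLp.toLp 2 (l.1, y)‖ := by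
  let t : (Ball d →₀ Y) →ₗ[ℂ] Y := Finsupp.lsum ℂ fun _ => LinearMap.id
  have ht : ∀ w y, t (.single w y) = y := fun w y => by simp [t]
  let T : (Ball d →₀ Y) →ₗ[ℂ] WithLp 2 (φ.Column × Y) :=
    (WithLp.linearEquiv 2 ℂ (φ.Column × Y)).symm.toLinearMap ∘ₗ
      φ.shiftedKernel.prod t
  have hT : ∀ x, T x = WithLp.toLp 2 (φ.shiftedKernel x, t x) := fun x => rfl
  have hTs : ∀ w y, T (.single w y) = WithLp.toLp 2 (φ.shiftedKernel (.single w y), y) := by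
    intro w y
    rw [hT, ht]
  have hiso : ∀ x, ‖a.adjointOp (T x)‖ = ‖T x‖ := by
    refine norm_finsupp_eq (S := a.adjointOp.toLinearMap ∘ₗ T) (T := T) fun z w y y' => ?_
    change ⟪a.adjointOp (T _), a.adjointOp (T _)⟫_ℂ = _
    rw [hTs, hTs, adjointOp_single, adjointOp_single, WithLp.prod_inner_apply,
      WithLp.prod_inner_apply]
    change ⟪RKHS.kerFun φ.DeBrangesRovnyak z y, RKHS.kerFun φ.DeBrangesRovnyak w y'⟫_ℂ
      + ⟪(φ z).adjoint y, (φ w).adjoint y'⟫_ℂ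
      = ⟪φ.shiftedKernel (.single z y), φ.shiftedKernel (.single w y')⟫_ℂ + ⟪y, y'⟫_ℂ
    rw [SchurMultiplier.shiftedKernel_single_eq, SchurMultiplier.shiftedKernel_single_eq,
      ContinuousLinearMap.adjoint_inner_left (φ z),
      ContinuousLinearMap.adjoint_inner_left (row φ.DeBrangesRovnyak z), row_apply,
      adjoint_row_apply, inner_sum]
    simp only [inner_smul_right, RKHS.kerFun_inner]
    have e : ∑ j, z.1 j * (conj (w.1 j) * ⟪y, RKHS.kerFun φ.DeBrangesRovnyak w y' z⟫_ℂ)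
        = ⟪w.1, z.1⟫_ℂ * ⟪y, RKHS.kerFun φ.DeBrangesRovnyak w y' z⟫_ℂ := by
      rw [inner_ball_eq, Finset.sum_mul]
      exact Finset.sum_congr rfl fun j _ => (mul_assoc _ _ _).symm
    rw [e, SchurMultiplier.kerFun_apply, inner_smul_right, inner_sub_right]
    linear_combination (⟪y, (φ z) ((φ w).adjoint y')⟫_ℂ - ⟪y, y'⟫_ℂ) * szego_mul z w
  refine SchurMultiplier.dSpace_induction (p := fun l => ‖a.adjointOp (WithLp.toLp 2 (l.1, y))‖
    = ‖WithLp.toLp 2 (l.1, y)‖) (isClosed_eq (by fun_prop) (by fun_prop)) (fun x => ?_) l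
  -- the vector at the origin shifts the second component only
  let x' : Ball d →₀ Y := x + Finsupp.single 0 (y - t x)
  have h0 : ∀ y, φ.shiftedKernel (.single 0 y) = 0 := fun y => by
    ext j : 1
    simp [SchurMultiplier.shiftedKernel_single]
  have hx' : T x' = WithLp.toLp 2 (φ.shiftedKernel x, y) := by
    rw [hT, map_add, h0, add_zero, map_add, ht, add_sub_cancel]
  have := hiso x'
  rwa [hx'] at this

end FunctionalModel

end FunctionalModelFacts

/-! ### Separability of the de Branges–Rovnyak space -/

section SeparableModel

open TopologicalSpace

lemma continuous_of_continuous_inner {X K : Type*} [TopologicalSpace X] [NormedAddCommGroup K]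
    [InnerProductSpace ℂ K] {g : X → K} (h : Continuous fun p : X × X => ⟪g p.1, g p.2⟫_ℂ) :
    Continuous g := by
  rw [continuous_iff_continuousAt]
  intro x₀
  rw [ContinuousAt, tendsto_iff_norm_sub_tendsto_zero]
  have h1 : Continuous fun x => RCLike.re ⟪g x, g x⟫_ℂ :=
    RCLike.continuous_re.comp (h.comp (continuous_id.prodMk continuous_id))
  have h2 : Continuous fun x => RCLike.re ⟪g x, g x₀⟫_ℂ :=
    RCLike.continuous_re.comp (h.comp (continuous_id.prodMk continuous_const))
  have h3 : Continuous fun x => ‖g x - g x₀‖ := by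
    have : (fun x => ‖g x - g x₀‖) = fun x => Real.sqrt (RCLike.re ⟪g x, g x⟫_ℂ
        - 2 * RCLike.re ⟪g x, g x₀⟫_ℂ + RCLike.re ⟪g x₀, g x₀⟫_ℂ) := by
      funext x
      rw [inner_self_eq_norm_sq, inner_self_eq_norm_sq, ← norm_sub_sq (𝕜 := ℂ),
        Real.sqrt_sq (norm_nonneg _)]
    rw [this]
    fun_prop
  simpa using h3.tendsto x₀

variable {d : ℕ} {U Y : Type*}
  [NormedAddCommGroup U] [InnerProductSpace ℂ U] [CompleteSpace U]
  [NormedAddCommGroup Y] [InnerProductSpace ℂ Y] [CompleteSpace Y]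

lemma SchurMultiplier.continuous (φ : SchurMultiplier d U Y) : Continuous φ.toFun := by
  have h := φ.holomorphic.continuousOn.domRestrict
  convert! h using 1
  funext z
  exact (Subtype.val_injective.extend_apply φ.toFun 0 z).symm

instance (φ : SchurMultiplier d U Y) [SeparableSpace Y] :
    SeparableSpace φ.DeBrangesRovnyak := by
  let g : Ball d × Y → φ.DeBrangesRovnyak := fun p => RKHS.kerFun φ.DeBrangesRovnyak p.1 p.2
  have hg : Continuous g := by
    refine continuous_of_continuous_inner ?_
    have hφ := φ.continuous
    have hφ' : Continuous fun z => (φ z).adjoint :=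
      (LinearIsometryEquiv.continuous ContinuousLinearMap.adjoint).comp hφ
    have hs : Continuous fun p : (Ball d × Y) × Ball d × Y => szego p.1.1 p.2.1 := by
      unfold szego
      exact (by fun_prop : Continuous fun p : (Ball d × Y) × Ball d × Y =>
        1 - ⟪p.2.1.1, p.1.1.1⟫_ℂ).inv₀ fun p => one_sub_inner_ne_zero _ _
    simp only [g, RKHS.kerFun_inner, SchurMultiplier.kerFun_apply]
    have h1 : Continuous fun p : (Ball d × Y) × Ball d × Y => (φ p.2.1).adjoint p.2.2 :=
      (hφ'.comp (by fun_prop)).clm_apply (by fun_prop)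
    have h2 : Continuous fun p : (Ball d × Y) × Ball d × Y =>
        φ p.1.1 ((φ p.2.1).adjoint p.2.2) := (hφ.comp (by fun_prop)).clm_apply h1
    fun_prop
  have h := ((isSeparable_range hg).span (R := ℂ)).closure
  have htop : closure (Submodule.span ℂ (Set.range g) : Set φ.DeBrangesRovnyak) = Set.univ := by
    rw [← Submodule.topologicalClosure_coe, ← Submodule.top_coe (R := ℂ),
      ← RKHS.kerFun_dense φ.DeBrangesRovnyak]
    congr 3
    ext f
    simp [g]
  rw [htop] at h
  exact isSeparable_univ_iff.1 h

end SeparableModel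

/-! ### Factorization through a self-adjoint operator -/

section Extension

variable {K L : Type*} [NormedAddCommGroup K] [InnerProductSpace ℂ K]
  [NormedAddCommGroup L] [InnerProductSpace ℂ L] [CompleteSpace L] {S : K →L[ℂ] K}

lemma extendAlong_apply_of_norm_le {T : K →L[ℂ] L} (h : ∀ x, ‖T x‖ ≤ ‖S x‖) (x : K) :
    extendAlong S.toLinearMap T.toLinearMap (toRangeClosure S.toLinearMap x) = T x :=
  extendAlong_apply ⟨1, fun x => by simpa using h x⟩ x

variable [CompleteSpace K]

/-- If `T = G S` with `S` self-adjoint then `T* = S G*`. -/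
lemma adjoint_eq_of_extendAlong (hS : S.adjoint = S) {T : K →L[ℂ] L} (h : ∀ x, ‖T x‖ ≤ ‖S x‖)
    (u : L) : T.adjoint u = S ((extendAlong S.toLinearMap T.toLinearMap).adjoint u) := by
  refine ext_inner_left ℂ fun x => ?_
  rw [ContinuousLinearMap.adjoint_inner_right, ← extendAlong_apply_of_norm_le h,
    ← ContinuousLinearMap.adjoint_inner_right]
  have hS' : ∀ v, ⟪S x, v⟫_ℂ = ⟪x, S v⟫_ℂ := fun v => by
    rw [← ContinuousLinearMap.adjoint_inner_right, hS]
  exact hS' _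

lemma eq_zero_of_mem_rangeClosure (hS : S.adjoint = S) {x : K}
    (hx : x ∈ rangeClosure S.toLinearMap) (h : S x = 0) : x = 0 := by
  have h0 : ∀ y : rangeClosure S.toLinearMap, ⟪(y : K), x⟫_ℂ = 0 :=
    rangeClosure_induction (isClosed_eq (by fun_prop) (by fun_prop)) fun y => by
      change ⟪S y, x⟫_ℂ = 0
      rw [← hS, ContinuousLinearMap.adjoint_inner_left, h, inner_zero_right]
  exact inner_self_eq_zero.1 (h0 ⟨x, hx⟩)

end Extension

/-! ### Contractive completions of an operator matrix with an isometric column -/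

section Completion

variable {H K L U : Type*}
  [NormedAddCommGroup H] [InnerProductSpace ℂ H] [NormedAddCommGroup K] [InnerProductSpace ℂ K]
  [NormedAddCommGroup L] [InnerProductSpace ℂ L] [NormedAddCommGroup U] [InnerProductSpace ℂ U]
  {T₁₁ : H →L[ℂ] K} {T₁₂ : L →L[ℂ] K} {X : H →L[ℂ] U} {T₂₂ : L →L[ℂ] U}

/-- The column `(T₁₂; T₂₂)` is isometric. -/
def IsColumnIsometry (T₁₂ : L →L[ℂ] K) (T₂₂ : L →L[ℂ] U) : Prop :=
  ∀ q, ‖T₁₂ q‖ ^ 2 + ‖T₂₂ q‖ ^ 2 = ‖q‖ ^ 2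

lemma IsColumnIsometry.norm_le (hc : IsColumnIsometry T₁₂ T₂₂) (q : L) : ‖T₁₂ q‖ ≤ ‖q‖ := by
  rw [← sq_le_sq₀ (norm_nonneg _) (norm_nonneg _)]
  nlinarith [hc q, sq_nonneg ‖T₂₂ q‖]

variable [CompleteSpace K] [CompleteSpace L]

lemma IsColumnIsometry.norm_defectOp_adjoint_sq (hc : IsColumnIsometry T₁₂ T₂₂) (f : K) :
    ‖defectOp T₁₂.adjoint f‖ ^ 2 = ‖f‖ ^ 2 - ‖T₁₂.adjoint f‖ ^ 2 :=
  norm_defectOp_sq (norm_adjoint_apply_le hc.norm_le) f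

lemma IsColumnIsometry.norm_eq (hc : IsColumnIsometry T₁₂ T₂₂) (q : L) :
    ‖T₂₂ q‖ = ‖defectOp T₁₂ q‖ := by
  rw [← sq_eq_sq₀ (norm_nonneg _) (norm_nonneg _), norm_defectOp_sq hc.norm_le,
    ← hc q, add_sub_cancel_left]

lemma IsColumnIsometry.adjoint_mem (hc : IsColumnIsometry T₁₂ T₂₂)
    (g : rangeClosure (defectOp T₁₂.adjoint).toLinearMap) :
    T₁₂.adjoint g ∈ rangeClosure (defectOp T₁₂).toLinearMap := by
  refine rangeClosure_induction (S := (defectOp T₁₂.adjoint).toLinearMap)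
    (p := fun g => T₁₂.adjoint g ∈ rangeClosure (defectOp T₁₂).toLinearMap) ?_ (fun f => ?_) g
  · exact (Submodule.isClosed_topologicalClosure _).preimage
      (T₁₂.adjoint.continuous.comp continuous_subtype_val)
  · change T₁₂.adjoint (defectOp T₁₂.adjoint f) ∈ _
    rw [adjoint_defectOp_adjoint_apply hc.norm_le]
    exact mem_rangeClosure (defectOp T₁₂).toLinearMap _

variable [CompleteSpace H]

/-- Contractivity of the row `(T₁₁ T₁₂)`, with the norms taken on the adjoint side. -/
def IsRowContraction (T₁₁ : H →L[ℂ] K) (T₁₂ : L →L[ℂ] K) : Prop :=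
  ∀ f, ‖T₁₁.adjoint f‖ ^ 2 + ‖T₁₂.adjoint f‖ ^ 2 ≤ ‖f‖ ^ 2

lemma IsRowContraction.norm_le (hr : IsRowContraction T₁₁ T₁₂) (hc : IsColumnIsometry T₁₂ T₂₂)
    (f : K) : ‖T₁₁.adjoint f‖ ≤ ‖defectOp T₁₂.adjoint f‖ := by
  rw [← sq_le_sq₀ (norm_nonneg _) (norm_nonneg _)]
  linarith [hc.norm_defectOp_adjoint_sq f, hr f]

/-- The operator `G₁` with `T₁₁* = G₁ (I - T₁₂ T₁₂*)^{1/2}`. -/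
def rowFactor (T₁₁ : H →L[ℂ] K) (T₁₂ : L →L[ℂ] K) :
    rangeClosure (defectOp T₁₂.adjoint).toLinearMap →L[ℂ] H :=
  extendAlong (defectOp T₁₂.adjoint).toLinearMap T₁₁.adjoint.toLinearMap

lemma norm_adjoint_rowFactor_le (hr : IsRowContraction T₁₁ T₁₂) (hc : IsColumnIsometry T₁₂ T₂₂)
    (h : H) : ‖(rowFactor T₁₁ T₁₂).adjoint h‖ ≤ ‖h‖ :=
  norm_adjoint_apply_le (norm_extendAlong_le (hr.norm_le hc)) h

lemma eq_defectOp_rowFactor (hr : IsRowContraction T₁₁ T₁₂) (hc : IsColumnIsometry T₁₂ T₂₂)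
    (h : H) : T₁₁ h = defectOp T₁₂.adjoint ((rowFactor T₁₁ T₁₂).adjoint h) := by
  have := adjoint_eq_of_extendAlong (adjoint_defectOp _) (hr.norm_le hc) h
  rwa [ContinuousLinearMap.adjoint_adjoint] at this

variable [CompleteSpace U]

/-- The operator `G₂` with `T₂₂ = G₂ (I - T₁₂* T₁₂)^{1/2}`. -/
def columnFactor (T₁₂ : L →L[ℂ] K) (T₂₂ : L →L[ℂ] U) :
    rangeClosure (defectOp T₁₂).toLinearMap →L[ℂ] U :=
  extendAlong (defectOp T₁₂).toLinearMap T₂₂.toLinearMap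

/-- The product `G₂ T₁₂* G₁*`, whose negative is the central corner of the contractive operators
`(T₁₁ T₁₂; X T₂₂)` with the other three corners given. -/
def factorProduct (T₁₁ : H →L[ℂ] K) (T₁₂ : L →L[ℂ] K) (T₂₂ : L →L[ℂ] U) : H →L[ℂ] U :=
  columnFactor T₁₂ T₂₂ ∘L (rangeClosure (defectOp T₁₂).toLinearMap).orthogonalProjectionOnto ∘L
    T₁₂.adjoint ∘L (rangeClosure (defectOp T₁₂.adjoint).toLinearMap).subtypeL ∘L
      (rowFactor T₁₁ T₁₂).adjoint

lemma columnFactor_apply (hc : IsColumnIsometry T₁₂ T₂₂) (q : L) :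
    columnFactor T₁₂ T₂₂ (toRangeClosure (defectOp T₁₂).toLinearMap q) = T₂₂ q :=
  extendAlong_apply_of_norm_le (fun q => (hc.norm_eq q).le) q

lemma norm_columnFactor_apply (hc : IsColumnIsometry T₁₂ T₂₂)
    (p : rangeClosure (defectOp T₁₂).toLinearMap) : ‖columnFactor T₁₂ T₂₂ p‖ = ‖p‖ := by
  refine rangeClosure_induction (p := fun p => ‖columnFactor T₁₂ T₂₂ p‖ = ‖p‖)
    (isClosed_eq (by fun_prop) (by fun_prop)) (fun q => ?_) p
  rw [columnFactor_apply hc, hc.norm_eq]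
  rfl

lemma adjoint_columnFactor_columnFactor (hc : IsColumnIsometry T₁₂ T₂₂)
    (p : rangeClosure (defectOp T₁₂).toLinearMap) :
    (columnFactor T₁₂ T₂₂).adjoint (columnFactor T₁₂ T₂₂ p) = p := by
  refine ext_inner_left ℂ fun p' => ?_
  rw [ContinuousLinearMap.adjoint_inner_right,
    inner_map_of_norm_eq (fun x => (norm_columnFactor_apply hc x).le)
      (norm_columnFactor_apply hc p)]

/-- If the ranges of the columns `(T₁₁; X)` and `(T₁₂; T₂₂)` are orthogonal, then the component
of `X` along the range of `G₂` is determined. -/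
lemma adjoint_columnFactor_apply (hr : IsRowContraction T₁₁ T₁₂) (hc : IsColumnIsometry T₁₂ T₂₂)
    (ho : ∀ h, T₁₂.adjoint (T₁₁ h) + T₂₂.adjoint (X h) = 0) (h : H) :
    ((columnFactor T₁₂ T₂₂).adjoint (X h) : L)
      = -T₁₂.adjoint ((rowFactor T₁₁ T₁₂).adjoint h) := by
  have h1 : T₂₂.adjoint (X h) = defectOp T₁₂ ((columnFactor T₁₂ T₂₂).adjoint (X h)) :=
    adjoint_eq_of_extendAlong (adjoint_defectOp _) (fun q => (hc.norm_eq q).le) (X h)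
  rw [← add_eq_zero_iff_eq_neg]
  refine eq_zero_of_mem_rangeClosure (S := defectOp T₁₂) (adjoint_defectOp _)
    (add_mem (SetLike.coe_mem _) (hc.adjoint_mem _)) ?_
  rw [map_add, ← adjoint_defectOp_adjoint_apply hc.norm_le, ← eq_defectOp_rowFactor hr hc, ← h1,
    add_comm, ho]

lemma factorProduct_apply (hr : IsRowContraction T₁₁ T₁₂) (hc : IsColumnIsometry T₁₂ T₂₂)
    (ho : ∀ h, T₁₂.adjoint (T₁₁ h) + T₂₂.adjoint (X h) = 0) (h : H) :
    factorProduct T₁₁ T₁₂ T₂₂ h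
      = -columnFactor T₁₂ T₂₂ ((columnFactor T₁₂ T₂₂).adjoint (X h)) := by
  have h1 : (rangeClosure (defectOp T₁₂).toLinearMap).orthogonalProjectionOnto
      (T₁₂.adjoint ((rowFactor T₁₁ T₁₂).adjoint h)) = -(columnFactor T₁₂ T₂₂).adjoint (X h) := by
    rw [← neg_neg (T₁₂.adjoint _), ← adjoint_columnFactor_apply hr hc ho, map_neg,
      Submodule.orthogonalProjectionOnto_mem_subspace_eq_self]
  change columnFactor T₁₂ T₂₂ ((rangeClosure (defectOp T₁₂).toLinearMap).orthogonalProjectionOnto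
      (T₁₂.adjoint ((rowFactor T₁₁ T₁₂).adjoint h))) = _
  rw [h1, map_neg]

lemma columnFactor_mem (hc : IsColumnIsometry T₁₂ T₂₂) {P : Submodule ℂ U}
    (hP : IsClosed (P : Set U)) (h : ∀ q, T₂₂ q ∈ P)
    (p : rangeClosure (defectOp T₁₂).toLinearMap) : columnFactor T₁₂ T₂₂ p ∈ P := by
  refine rangeClosure_induction (p := fun p => columnFactor T₁₂ T₂₂ p ∈ P)
    (hP.preimage (columnFactor T₁₂ T₂₂).continuous) (fun q => ?_) p
  rw [columnFactor_apply hc]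
  exact h q

/-- The defect of `G₁*` exceeds `X + G₂ T₁₂* G₁*` by the defect of the column `(T₁₁; X)`. -/
lemma norm_defectOp_rowFactor_sq (hr : IsRowContraction T₁₁ T₁₂) (hc : IsColumnIsometry T₁₂ T₂₂)
    (ho : ∀ h, T₁₂.adjoint (T₁₁ h) + T₂₂.adjoint (X h) = 0) (h : H) :
    ‖defectOp (rowFactor T₁₁ T₁₂).adjoint h‖ ^ 2 - ‖X h + factorProduct T₁₁ T₁₂ T₂₂ h‖ ^ 2
      = ‖h‖ ^ 2 - (‖T₁₁ h‖ ^ 2 + ‖X h‖ ^ 2) := by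
  have hX : ‖X h‖ ^ 2 = ‖X h + factorProduct T₁₁ T₁₂ T₂₂ h‖ ^ 2
      + ‖T₁₂.adjoint ((rowFactor T₁₁ T₁₂).adjoint h)‖ ^ 2 := by
    have h1 : X h = (X h + factorProduct T₁₁ T₁₂ T₂₂ h)
        + columnFactor T₁₂ T₂₂ ((columnFactor T₁₂ T₂₂).adjoint (X h)) := by
      rw [factorProduct_apply hr hc ho, neg_add_cancel_right]
    have h0 : ⟪X h + factorProduct T₁₁ T₁₂ T₂₂ h,
        columnFactor T₁₂ T₂₂ ((columnFactor T₁₂ T₂₂).adjoint (X h))⟫_ℂ = 0 := by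
      rw [← ContinuousLinearMap.adjoint_inner_left, factorProduct_apply hr hc ho, map_add, map_neg,
        adjoint_columnFactor_columnFactor hc, add_neg_cancel, inner_zero_left]
    have h2 : ‖columnFactor T₁₂ T₂₂ ((columnFactor T₁₂ T₂₂).adjoint (X h))‖
        = ‖T₁₂.adjoint ((rowFactor T₁₁ T₁₂).adjoint h)‖ := by
      rw [norm_columnFactor_apply hc, Submodule.coe_norm, adjoint_columnFactor_apply hr hc ho,
        norm_neg]
    conv_lhs => rw [h1, norm_add_sq (𝕜 := ℂ), h0, h2]
    simp
  have hT : ‖T₁₁ h‖ ^ 2 = ‖(rowFactor T₁₁ T₁₂).adjoint h‖ ^ 2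
      - ‖T₁₂.adjoint ((rowFactor T₁₁ T₁₂).adjoint h)‖ ^ 2 := by
    rw [eq_defectOp_rowFactor hr hc h]
    exact hc.norm_defectOp_adjoint_sq _
  have hΔ := norm_defectOp_sq (norm_adjoint_rowFactor_le hr hc) h
  linarith

end Completion

/-! ### The canonical modification is coisometric -/

section CanonicalModification

open Colligation

variable {d : ℕ} {U Y : Type*}
  [NormedAddCommGroup U] [InnerProductSpace ℂ U] [CompleteSpace U]
  [NormedAddCommGroup Y] [InnerProductSpace ℂ Y] [CompleteSpace Y]

/-- A colligation whose adjoint is isometric. -/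
def Colligation.IsCoisometric {d : ℕ} {K U Y : Type*}
    [NormedAddCommGroup K] [InnerProductSpace ℂ K] [CompleteSpace K]
    [NormedAddCommGroup U] [InnerProductSpace ℂ U] [CompleteSpace U]
    [NormedAddCommGroup Y] [InnerProductSpace ℂ Y] [CompleteSpace Y]
    (c : Colligation d K U Y) : Prop := ∀ q, ‖c.adjointOp q‖ = ‖q‖

namespace FunctionalModel

variable {φ : SchurMultiplier d U Y} (a : FunctionalModel φ)

lemma T₁₂_apply (q : WithLp 2 (φ.DSpace × Y)) :
    a.T₁₂ q = a.A.adjoint q.fst + a.C.adjoint q.snd := rfl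

lemma T₂₂_apply (q : WithLp 2 (φ.DSpace × Y)) :
    φ.T₂₂ q = a.B.adjoint q.fst + a.D.adjoint q.snd := by
  rw [a.D_eq, ← a.R_apply]
  rfl

lemma adjointOp_eq (q : WithLp 2 (φ.DSpace × Y)) :
    a.adjointOp (WithLp.toLp 2 (q.fst.1, q.snd)) = WithLp.toLp 2 (a.T₁₂ q, φ.T₂₂ q) := by
  rw [adjointOp_apply, T₁₂_apply, a.T₂₂_apply]

lemma adjointOp_orthogonal (h : φ.DSpaceᗮ) :
    a.adjointOp (WithLp.toLp 2 (h.1, 0)) = WithLp.toLp 2 (a.T₁₁ h, a.X h) := by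
  rw [adjointOp_apply, map_zero, map_zero, add_zero, add_zero]
  rfl

lemma isColumnIsometry : IsColumnIsometry a.T₁₂ φ.T₂₂ := by
  intro q
  have h := congrArg (· ^ 2) (a.norm_adjointOp_eq q.fst q.snd)
  simp only [adjointOp_eq, WithLp.prod_norm_sq_eq_of_L2] at h
  rw [WithLp.prod_norm_sq_eq_of_L2]
  exact h

lemma norm_T₁₁_sq_add_le (h : φ.DSpaceᗮ) : ‖a.T₁₁ h‖ ^ 2 + ‖a.X h‖ ^ 2 ≤ ‖h‖ ^ 2 := by
  have := pow_le_pow_left₀ (norm_nonneg _)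
    (a.norm_adjointOp_le a.contractive (WithLp.toLp 2 (h.1, 0))) 2
  rw [adjointOp_orthogonal, WithLp.prod_norm_sq_eq_of_L2, WithLp.prod_norm_sq_eq_of_L2] at this
  simpa using this

lemma inner_adjointOp (h : φ.DSpaceᗮ) (q : WithLp 2 (φ.DSpace × Y)) :
    ⟪a.adjointOp (WithLp.toLp 2 (h.1, 0)), a.adjointOp (WithLp.toLp 2 (q.fst.1, q.snd))⟫_ℂ = 0 := by
  rw [inner_map_of_norm_eq (a.norm_adjointOp_le a.contractive) (a.norm_adjointOp_eq _ _),
    WithLp.prod_inner_apply]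
  simp [Submodule.inner_left_of_mem_orthogonal q.fst.2 h.2]

lemma adjoint_T_add (h : φ.DSpaceᗮ) : a.T₁₂.adjoint (a.T₁₁ h) + φ.T₂₂.adjoint (a.X h) = 0 := by
  refine ext_inner_right ℂ fun q => ?_
  have := a.inner_adjointOp h q
  rw [adjointOp_eq, adjointOp_orthogonal, WithLp.prod_inner_apply] at this
  rw [inner_add_left, ContinuousLinearMap.adjoint_inner_left,
    ContinuousLinearMap.adjoint_inner_left, inner_zero_left]
  exact this

lemma adjoint_T₁₁_apply (f : φ.DeBrangesRovnyak) :
    a.T₁₁.adjoint f = φ.DSpaceᗮ.orthogonalProjectionOnto (a.A f) := by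
  refine ext_inner_left ℂ fun h => ?_
  rw [ContinuousLinearMap.adjoint_inner_right]
  change ⟪a.A.adjoint h, f⟫_ℂ = _
  rw [ContinuousLinearMap.adjoint_inner_left,
    Submodule.inner_orthogonalProjectionOnto_eq_of_mem_left]

lemma adjoint_T₁₂_apply (f : φ.DeBrangesRovnyak) :
    a.T₁₂.adjoint f = WithLp.toLp 2 (φ.DSpace.orthogonalProjectionOnto (a.A f), a.C f) := by
  refine ext_inner_left ℂ fun q => ?_
  rw [ContinuousLinearMap.adjoint_inner_right, T₁₂_apply, inner_add_left,
    ContinuousLinearMap.adjoint_inner_left, ContinuousLinearMap.adjoint_inner_left,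
    WithLp.prod_inner_apply]
  change _ = ⟪q.fst, φ.DSpace.orthogonalProjectionOnto (a.A f)⟫_ℂ + ⟪q.snd, a.C f⟫_ℂ
  rw [Submodule.inner_orthogonalProjectionOnto_eq_of_mem_left]

lemma isRowContraction : IsRowContraction a.T₁₁ a.T₁₂ := by
  intro f
  have h := a.contractive f 0
  rw [adjoint_T₁₁_apply, adjoint_T₁₂_apply, WithLp.prod_norm_sq_eq_of_L2]
  change ‖φ.DSpaceᗮ.orthogonalProjectionOnto (a.A f)‖ ^ 2
    + (‖φ.DSpace.orthogonalProjectionOnto (a.A f)‖ ^ 2 + ‖a.C f‖ ^ 2) ≤ _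
  have h1 := Submodule.norm_sq_eq_add_norm_sq_projection (a.A f) φ.DSpace
  simp only [map_zero, add_zero, norm_zero] at h
  linarith

lemma G₂T₁₂G₁_eq : a.G₂T₁₂G₁ = factorProduct a.T₁₁ a.T₁₂ φ.T₂₂ := rfl

lemma mem_nullSpace_iff (u : U) : u ∈ φ.nullSpace ↔ ∀ z, φ z u = 0 := by
  simp [SchurMultiplier.nullSpace]

lemma inner_T₂₂_single (a : FunctionalModel φ) (w : Ball d) (y : Y) (u : U) :
    ⟪φ.T₂₂ (WithLp.toLp 2 (φ.toDSpace (.single w y), y)), u⟫_ℂ = ⟪y, φ w u⟫_ℂ := by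
  rw [a.T₂₂_apply]
  change ⟪a.B.adjoint (φ.shiftedKernel (.single w y)) + a.D.adjoint y, u⟫_ℂ = _
  rw [adjoint_B_shiftedKernel_single, a.D_eq, sub_add_cancel,
    ContinuousLinearMap.adjoint_inner_left]

/-- The range of `T₂₂` spans the orthogonal complement of the null space. -/
lemma mem_nullSpace_iff_inner_T₂₂ (a : FunctionalModel φ) (u : U) :
    u ∈ φ.nullSpace ↔ ∀ q, ⟪φ.T₂₂ q, u⟫_ℂ = 0 := by
  rw [mem_nullSpace_iff]
  constructor
  · intro hu q
    have hl : ∀ l : φ.DSpace, ⟪a.B.adjoint l, u⟫_ℂ = 0 :=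
      SchurMultiplier.dSpace_induction (isClosed_eq (by fun_prop) (by fun_prop)) fun x => by
        rw [SchurMultiplier.coe_toDSpace]
        induction x using Finsupp.induction_linear with
        | zero => simp
        | add f g hf hg => rw [map_add, map_add, inner_add_left, hf, hg, add_zero]
        | single w y =>
          rw [adjoint_B_shiftedKernel_single, inner_sub_left,
            ContinuousLinearMap.adjoint_inner_left, ContinuousLinearMap.adjoint_inner_left, hu, hu,
            sub_self]
    rw [a.T₂₂_apply, inner_add_left, hl, ContinuousLinearMap.adjoint_inner_left, a.D_eq, hu,
      inner_zero_right, add_zero]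
  · intro h z
    refine ext_inner_left ℂ fun y => ?_
    rw [← a.inner_T₂₂_single, h, inner_zero_right]

lemma T₂₂_mem (a : FunctionalModel φ) (q : WithLp 2 (φ.DSpace × Y)) : φ.T₂₂ q ∈ φ.nullSpaceᗮ := by
  rw [Submodule.mem_orthogonal']
  exact fun u hu => (a.mem_nullSpace_iff_inner_T₂₂ u).1 hu q

lemma G₂T₁₂G₁_mem (h : φ.DSpaceᗮ) : a.G₂T₁₂G₁ h ∈ φ.nullSpaceᗮ := by
  rw [G₂T₁₂G₁_eq, factorProduct_apply a.isRowContraction a.isColumnIsometry a.adjoint_T_add]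
  exact neg_mem (columnFactor_mem a.isColumnIsometry (Submodule.isClosed_orthogonal _) a.T₂₂_mem _)

lemma norm_Δ_sq (h : φ.DSpaceᗮ) : ‖a.Δ h‖ ^ 2 - ‖a.X h + a.G₂T₁₂G₁ h‖ ^ 2
    = ‖h‖ ^ 2 - (‖a.T₁₁ h‖ ^ 2 + ‖a.X h‖ ^ 2) :=
  norm_defectOp_rowFactor_sq a.isRowContraction a.isColumnIsometry a.adjoint_T_add h

lemma norm_X_add_le (h : φ.DSpaceᗮ) : ‖(a.X + a.G₂T₁₂G₁) h‖ ≤ ‖a.Δ h‖ := by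
  rw [← sq_le_sq₀ (norm_nonneg _) (norm_nonneg _)]
  have h1 := a.norm_Δ_sq h
  have h2 := a.norm_T₁₁_sq_add_le h
  rw [add_apply]
  linarith

lemma ξ_toDefect (h : φ.DSpaceᗮ) : a.ξ (a.toDefect h) = a.X h + a.G₂T₁₂G₁ h :=
  extendAlong_apply_of_norm_le a.norm_X_add_le h

lemma norm_ξ_le (k : a.DefectSpace) : ‖a.ξ k‖ ≤ ‖k‖ := norm_extendAlong_le a.norm_X_add_le k

lemma norm_Δξ_toDefect_sq (h : φ.DSpaceᗮ) :
    ‖a.Δξ (a.toDefect h)‖ ^ 2 = ‖h‖ ^ 2 - (‖a.T₁₁ h‖ ^ 2 + ‖a.X h‖ ^ 2) := by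
  rw [Δξ, norm_defectOp_sq a.norm_ξ_le, ξ_toDefect, ← norm_Δ_sq]
  rfl

lemma adjoint_J_apply (u : U) :
    a.J.adjoint u = WithLp.toLp 2 (φ.nullSpaceᗮ.starProjection u, 0) := by
  refine ext_inner_left ℂ fun n => ?_
  rw [ContinuousLinearMap.adjoint_inner_right, WithLp.prod_inner_apply]
  change ⟪φ.nullSpaceᗮ.starProjection n.fst, u⟫_ℂ
    = ⟪n.fst, φ.nullSpaceᗮ.starProjection u⟫_ℂ + ⟪n.snd, (0 : a.DefectSpace)⟫_ℂ
  rw [Submodule.inner_starProjection_left_eq_right, inner_zero_right, add_zero]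

lemma adjoint_J_of_mem {u : U} (hu : u ∈ φ.nullSpaceᗮ) :
    a.J.adjoint u = WithLp.toLp 2 (u, 0) := by
  rw [adjoint_J_apply, Submodule.starProjection_eq_self_iff.2 hu]

lemma R_mem (a : FunctionalModel φ) (l : φ.DSpace) : φ.R l ∈ φ.nullSpaceᗮ := by
  simpa [SchurMultiplier.T₂₂] using a.T₂₂_mem (WithLp.toLp 2 (l, 0))

lemma adjoint_apply_mem (z : Ball d) (y : Y) : (φ z).adjoint y ∈ φ.nullSpaceᗮ := by
  rw [Submodule.mem_orthogonal]
  intro u hu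
  rw [ContinuousLinearMap.adjoint_inner_right, (mem_nullSpace_iff u).1 hu, inner_zero_left]

/-- The canonical modification only adds to `B*` the component `(I - ξ* ξ)^{1/2} (I - G₁ G₁*)^{1/2}`
on `𝒟_φᗮ`. -/
lemma BJadjoint_apply (x : φ.Column) : a.BJadjoint x = WithLp.toLp 2 (a.B.adjoint x,
    a.Δξ (a.toDefect (φ.DSpaceᗮ.orthogonalProjectionOnto x))) := by
  set h := φ.DSpaceᗮ.orthogonalProjectionOnto x with hh
  set l := φ.DSpace.orthogonalProjectionOnto x with hl
  have hx : x = l + h := (φ.DSpace.starProjection_add_starProjection_orthogonal x).symm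
  have h1 : a.BJadjoint x = -(a.J.adjoint (a.G₂T₁₂G₁ h)) + a.ξiso (a.toDefect h)
      + a.J.adjoint (φ.R l) := rfl
  have h2 : a.ξiso (a.toDefect h) = WithLp.toLp 2 (a.ξ (a.toDefect h), a.Δξ (a.toDefect h)) := rfl
  have h4 : a.B.adjoint x = φ.R l + a.X h := by
    conv_lhs => rw [hx, map_add, ← a.R_apply]
    rfl
  rw [h1, h2, ξ_toDefect, adjoint_J_of_mem _ (a.G₂T₁₂G₁_mem h), adjoint_J_of_mem _ (a.R_mem l), h4,
    ← WithLp.toLp_neg, ← WithLp.toLp_add, ← WithLp.toLp_add]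
  congr 1
  refine Prod.ext ?_ ?_
  · change -(a.G₂T₁₂G₁ h) + (a.X h + a.G₂T₁₂G₁ h) + φ.R l = φ.R l + a.X h
    abel
  · change -0 + a.Δξ (a.toDefect h) + 0 = a.Δξ (a.toDefect h)
    simp

lemma adjoint_canonical_D (y : Y) :
    a.canonical.D.adjoint y = WithLp.toLp 2 (a.D.adjoint y, 0) := by
  rw [canonical, ContinuousLinearMap.adjoint_comp, ContinuousLinearMap.comp_apply,
    adjoint_J_of_mem _ (adjoint_apply_mem 0 y), a.D_eq]

/-- The canonical modification is coisometric: the added component makes up for the defect of the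
adjoint colligation, which vanishes on `𝒟_φ ⊕ Y`. -/
lemma canonical_isCoisometric : a.canonical.IsCoisometric := by
  rintro ⟨x, y⟩
  set h := φ.DSpaceᗮ.orthogonalProjectionOnto x with hh
  set l := φ.DSpace.orthogonalProjectionOnto x with hl
  have hx : x = h + l := by
    rw [add_comm]
    exact (φ.DSpace.starProjection_add_starProjection_orthogonal x).symm
  have hV : a.adjointOp (WithLp.toLp 2 (x, y)) = a.adjointOp (WithLp.toLp 2 (h.1, 0))
      + a.adjointOp (WithLp.toLp 2 (l.1, y)) := by
    rw [← map_add, ← WithLp.toLp_add, Prod.mk_add_mk, zero_add, ← hx]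
  have h1 := congrArg (fun v => ‖v‖ ^ 2) hV
  have h0 : ⟪a.adjointOp (WithLp.toLp 2 (h.1, 0)), a.adjointOp (WithLp.toLp 2 (l.1, y))⟫_ℂ = 0 :=
    a.inner_adjointOp h (WithLp.toLp 2 (l, y))
  rw [norm_add_sq (𝕜 := ℂ), h0, a.norm_adjointOp_eq, adjointOp_orthogonal, adjointOp_apply] at h1
  simp only [WithLp.prod_norm_sq_eq_of_L2, map_zero, mul_zero, add_zero] at h1
  change ‖a.A.adjoint x + a.C.adjoint y‖ ^ 2 + ‖a.B.adjoint x + a.D.adjoint y‖ ^ 2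
    = ‖a.T₁₁ h‖ ^ 2 + ‖a.X h‖ ^ 2 + (‖l‖ ^ 2 + ‖y‖ ^ 2) at h1
  have h2 := a.norm_Δξ_toDefect_sq h
  have h3 := Submodule.norm_sq_eq_add_norm_sq_projection x φ.DSpace
  rw [← sq_eq_sq₀ (norm_nonneg _) (norm_nonneg _), adjointOp_apply, adjoint_canonical_D]
  have h4 : a.canonical.B.adjoint x = a.BJadjoint x := by
    rw [canonical, ContinuousLinearMap.adjoint_adjoint]
  rw [h4, BJadjoint_apply, ← WithLp.toLp_add, Prod.mk_add_mk, add_zero]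
  simp only [WithLp.prod_norm_sq_eq_of_L2]
  change ‖a.A.adjoint x + a.C.adjoint y‖ ^ 2 + (‖a.B.adjoint x + a.D.adjoint y‖ ^ 2
    + ‖a.Δξ (a.toDefect h)‖ ^ 2) = ‖x‖ ^ 2 + ‖y‖ ^ 2
  rw [h2, h3]
  linarith

end FunctionalModel

end CanonicalModification

/-! ### Coisometric colligations with the same output pair -/

section Augmentation

open Colligation

variable {d : ℕ} {K U Y K' U' Y' : Type*}
  [NormedAddCommGroup K] [InnerProductSpace ℂ K]
  [NormedAddCommGroup U] [InnerProductSpace ℂ U]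
  [NormedAddCommGroup Y] [InnerProductSpace ℂ Y]
  [NormedAddCommGroup K'] [InnerProductSpace ℂ K']
  [NormedAddCommGroup U'] [InnerProductSpace ℂ U']
  [NormedAddCommGroup Y'] [InnerProductSpace ℂ Y']
  {c : Colligation d K U Y} {c' : Colligation d K' U' Y'} {Λ : K ≃ₗᵢ[ℂ] K'} {β : Y ≃ₗᵢ[ℂ] Y'}

namespace Colligation

variable (c c' Λ β) in
/-- The output pairs `(C, A)` and `(C', A')` of two colligations are intertwined by the unitary
operators `Λ` and `β`. -/
def IntertwinesOutput : Prop :=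
  (∀ x, LinearIsometryEquiv.piLpCongrRight 2 (fun _ : Fin d => Λ) (c.A x) = c'.A (Λ x)) ∧
    ∀ x, β (c.C x) = c'.C (Λ x)

lemma IntertwinesOutput.symm (h : IntertwinesOutput c c' Λ β) :
    IntertwinesOutput c' c Λ.symm β.symm := by
  refine ⟨fun x => ?_, fun x => ?_⟩
  · rw [← LinearIsometryEquiv.piLpCongrRight_symm, LinearIsometryEquiv.symm_apply_eq, h.1,
      LinearIsometryEquiv.apply_symm_apply]
  · rw [LinearIsometryEquiv.symm_apply_eq, h.2, LinearIsometryEquiv.apply_symm_apply]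

variable [CompleteSpace K] [CompleteSpace Y] [CompleteSpace K'] [CompleteSpace Y']

lemma IntertwinesOutput.adjoint_apply (h : IntertwinesOutput c c' Λ β)
    (x : PiLp 2 fun _ : Fin d => K) (y : Y) :
    c'.A.adjoint (LinearIsometryEquiv.piLpCongrRight 2 (fun _ : Fin d => Λ) x)
      + c'.C.adjoint (β y) = Λ (c.A.adjoint x + c.C.adjoint y) := by
  refine ext_inner_right ℂ fun k => ?_
  obtain ⟨k, rfl⟩ := Λ.surjective k
  rw [inner_add_left, ContinuousLinearMap.adjoint_inner_left,
    ContinuousLinearMap.adjoint_inner_left, ← h.1, ← h.2, LinearIsometryEquiv.inner_map_map,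
    LinearIsometryEquiv.inner_map_map, LinearIsometryEquiv.inner_map_map, inner_add_left,
    ContinuousLinearMap.adjoint_inner_left, ContinuousLinearMap.adjoint_inner_left]

variable [CompleteSpace U] [CompleteSpace U']

/-- A unitary operator between the input spaces that intertwines the operators `(B* D*)` yields a
unitary coincidence. -/
lemma IntertwinesOutput.unitarilyCoincident (h : IntertwinesOutput c c' Λ β) {H : Type*}
    [NormedAddCommGroup H] [InnerProductSpace ℂ H] (Ω : WithLp 2 (U × H) ≃ₗᵢ[ℂ] U')
    (hΩ : ∀ x y, Ω (WithLp.toLp 2 (c.B.adjoint x + c.D.adjoint y, 0)) =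
      c'.B.adjoint (LinearIsometryEquiv.piLpCongrRight 2 (fun _ : Fin d => Λ) x)
        + c'.D.adjoint (β y)) :
    (c.augment H).UnitarilyCoincident c' := by
  have hinner : ∀ (v : U) (u : WithLp 2 (U × H)),
      ⟪v, u.fst⟫_ℂ = ⟪Ω (WithLp.toLp 2 (v, 0)), Ω u⟫_ℂ := by
    intro v u
    rw [LinearIsometryEquiv.inner_map_map, WithLp.prod_inner_apply]
    simp
  have hB : ∀ u, LinearIsometryEquiv.piLpCongrRight 2 (fun _ : Fin d => Λ) (c.B u.fst)
      = c'.B (Ω u) := by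
    intro u
    refine ext_inner_left ℂ fun x => ?_
    obtain ⟨x, rfl⟩ := (LinearIsometryEquiv.piLpCongrRight 2 (fun _ : Fin d => Λ)).surjective x
    have := hΩ x 0
    simp only [map_zero, add_zero] at this
    rw [LinearIsometryEquiv.inner_map_map, ← ContinuousLinearMap.adjoint_inner_left, hinner, this,
      ContinuousLinearMap.adjoint_inner_left]
  have hD : ∀ u, β (c.D u.fst) = c'.D (Ω u) := by
    intro u
    refine ext_inner_left ℂ fun y => ?_
    obtain ⟨y, rfl⟩ := β.surjective y
    have := hΩ 0 y
    simp only [map_zero, zero_add] at this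
    rw [LinearIsometryEquiv.inner_map_map, ← ContinuousLinearMap.adjoint_inner_left, hinner, this,
      ContinuousLinearMap.adjoint_inner_left]
  refine ⟨Λ, Ω, β, fun x u => ⟨?_, ?_⟩⟩
  · rw [map_add, ← hB, ← h.1]
    rfl
  · rw [map_add, ← hD, ← h.2]
    rfl

lemma IsCoisometric.norm_sq (hc : c.IsCoisometric) (x : PiLp 2 fun _ : Fin d => K) (y : Y) :
    ‖c.B.adjoint x + c.D.adjoint y‖ ^ 2
      = ‖x‖ ^ 2 + ‖y‖ ^ 2 - ‖c.A.adjoint x + c.C.adjoint y‖ ^ 2 := by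
  have h := congrArg (fun r => r ^ 2) (hc (WithLp.toLp 2 (x, y)))
  rw [adjointOp_apply] at h
  simp only [WithLp.prod_norm_sq_eq_of_L2] at h
  rw [eq_sub_iff_add_eq, add_comm]
  exact h

/-- Coisometric colligations with unitarily equivalent output pairs are unitarily coincident up to a
summand of one of the input spaces on which the colligation vanishes: as `B* x + D* y` has the norm
`‖x‖² + ‖y‖² - ‖A* x + C* y‖²`, the operators `(B* D*)` of the two colligations differ by a unitary
operator between the closures of their ranges. -/
lemma IntertwinesOutput.exists_augment [TopologicalSpace.SeparableSpace U]
    [TopologicalSpace.SeparableSpace U'] (h : IntertwinesOutput c c' Λ β) (hc : c.IsCoisometric)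
    (hc' : c'.IsCoisometric) :
    ∃ (H : Type) (_ : NormedAddCommGroup H) (_ : InnerProductSpace ℂ H)
      (_ : CompleteSpace H) (_ : TopologicalSpace.SeparableSpace H),
      (c.augment H).UnitarilyCoincident c' ∨ (c'.augment H).UnitarilyCoincident c := by
  let Λd := LinearIsometryEquiv.piLpCongrRight 2 (fun _ : Fin d => Λ)
  let S : (PiLp 2 fun _ : Fin d => K) × Y →ₗ[ℂ] U :=
    c.B.adjoint.toLinearMap.coprod c.D.adjoint.toLinearMap
  let T : (PiLp 2 fun _ : Fin d => K) × Y →ₗ[ℂ] U' :=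
    (c'.B.adjoint.toLinearMap ∘ₗ Λd.toLinearEquiv.toLinearMap).coprod
      (c'.D.adjoint.toLinearMap ∘ₗ β.toLinearEquiv.toLinearMap)
  have hS : ∀ x y, S (x, y) = c.B.adjoint x + c.D.adjoint y := fun x y => rfl
  have hT : ∀ x y, T (x, y) = c'.B.adjoint (Λd x) + c'.D.adjoint (β y) := fun x y => rfl
  obtain ⟨H, i1, i2, i3, i4, ⟨Ω, hΩ⟩ | ⟨Ω, hΩ⟩⟩ := exists_unitary_of_norm_eq S T fun ⟨x, y⟩ => by
    rw [← sq_eq_sq₀ (norm_nonneg _) (norm_nonneg _), hS, hT, hc.norm_sq, hc'.norm_sq,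
      h.adjoint_apply, Λ.norm_map, Λd.norm_map, β.norm_map]
  · exact ⟨H, i1, i2, i3, i4, .inl (h.unitarilyCoincident Ω fun x y => hΩ (x, y))⟩
  · refine ⟨H, i1, i2, i3, i4, .inr (h.symm.unitarilyCoincident Ω fun x y => ?_)⟩
    have := hΩ (Λd.symm x, β.symm y)
    rw [hT, hS, Λd.apply_symm_apply, β.apply_symm_apply] at this
    exact this

end Colligation

end Augmentation

/-! ### Functional models of coincident multipliers -/

section CoincidentMultipliers

variable {d : ℕ} {U Y V W : Type*}
  [NormedAddCommGroup U] [InnerProductSpace ℂ U] [CompleteSpace U]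
  [NormedAddCommGroup Y] [InnerProductSpace ℂ Y] [CompleteSpace Y]
  [NormedAddCommGroup V] [InnerProductSpace ℂ V] [CompleteSpace V]
  [NormedAddCommGroup W] [InnerProductSpace ℂ W] [CompleteSpace W]
  {φ : SchurMultiplier d U Y} {ψ : SchurMultiplier d V W}

lemma SchurMultiplier.isClosed_nullSpace (φ : SchurMultiplier d U Y) :
    IsClosed (φ.nullSpace : Set U) := by
  simp only [nullSpace, Submodule.coe_iInf]
  exact isClosed_iInter fun z => (φ z).isClosed_ker

instance (φ : SchurMultiplier d U Y) : CompleteSpace φ.nullSpace :=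
  φ.isClosed_nullSpace.completeSpace_coe

lemma Coincide.symm (h : Coincide φ ψ) : Coincide ψ φ := by
  obtain ⟨α, β, h⟩ := h
  exact ⟨α.symm, β.symm, fun z v => by
    rw [LinearIsometryEquiv.symm_apply_eq, h, LinearIsometryEquiv.apply_symm_apply]⟩

variable {α : U ≃ₗᵢ[ℂ] V} {β : Y ≃ₗᵢ[ℂ] W}

lemma exists_nullSpace_equiv (h : ∀ z u, β (φ z u) = ψ z (α u)) :
    Nonempty (φ.nullSpace ≃ₗᵢ[ℂ] ψ.nullSpace) := by
  refine ⟨(α.submoduleMap φ.nullSpace).trans (.ofEq _ _ ?_)⟩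
  ext v
  obtain ⟨u, rfl⟩ := α.surjective v
  have : α u ∈ φ.nullSpace.map α.toLinearEquiv.toLinearMap ↔ u ∈ φ.nullSpace :=
    ⟨fun ⟨u', hu', e⟩ => α.injective e ▸ hu', fun hu => ⟨u, hu, rfl⟩⟩
  refine this.trans ?_
  simp [FunctionalModel.mem_nullSpace_iff, ← h]

lemma adjoint_apply_of_coincide (h : ∀ z u, β (φ z u) = ψ z (α u)) (z : Ball d) (y : Y) :
    (ψ z).adjoint (β y) = α ((φ z).adjoint y) := by
  refine ext_inner_right ℂ fun v => ?_
  obtain ⟨u, rfl⟩ := α.surjective v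
  rw [ContinuousLinearMap.adjoint_inner_left, ← h, LinearIsometryEquiv.inner_map_map,
    LinearIsometryEquiv.inner_map_map, ContinuousLinearMap.adjoint_inner_left]

/-- For coincident multipliers, the operator `f ↦ β f` is unitary from `H(k_φ)` to `H(k_ψ)` and
intertwines the output pairs of all functional models. -/
lemma exists_intertwinesOutput (h : ∀ z u, β (φ z u) = ψ z (α u)) (a : FunctionalModel φ)
    (b : FunctionalModel ψ) : ∃ Λ : φ.DeBrangesRovnyak ≃ₗᵢ[ℂ] ψ.DeBrangesRovnyak,
      Colligation.IntertwinesOutput a.toColligation b.toColligation Λ β := by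
  obtain ⟨Λ, hΛ⟩ := exists_rkhs_equiv (H := φ.DeBrangesRovnyak) (H' := ψ.DeBrangesRovnyak) β
    fun x y v => by
      rw [φ.kernel_deBrangesRovnyak, ψ.kernel_deBrangesRovnyak]
      change β (szego x y • (v - φ x ((φ y).adjoint v)))
        = szego x y • (β v - ψ x ((ψ y).adjoint (β v)))
      rw [map_smul, map_sub, h, adjoint_apply_of_coincide h]
  obtain ⟨Γ, hΓ⟩ := exists_rkhs_equiv (H := DruryArveson d Y) (H' := DruryArveson d W) β
    fun x y v => by
      rw [kernel_druryArveson, kernel_druryArveson]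
      simp [arvesonKernel]
  have hΓM : ∀ j F, (coordMul W j).adjoint (Γ F) = Γ ((coordMul Y j).adjoint F) := by
    intro j F
    refine ext_inner_right ℂ fun G => ?_
    obtain ⟨G, rfl⟩ := Γ.surjective G
    have : coordMul W j (Γ G) = Γ (coordMul Y j G) := RKHS.ext fun z => by
      rw [coordMul_apply, hΓ, hΓ, coordMul_apply, map_smul]
    rw [ContinuousLinearMap.adjoint_inner_left, this, LinearIsometryEquiv.inner_map_map,
      LinearIsometryEquiv.inner_map_map, ContinuousLinearMap.adjoint_inner_left]
  refine ⟨Λ, fun f => ?_, fun f => ?_⟩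
  · ext j : 1
    refine RKHS.ext fun z => ?_
    obtain ⟨F, hF, hFA⟩ := a.A_eq f j
    obtain ⟨G, hG, hGA⟩ := b.A_eq (Λ f) j
    have hGF : G = Γ F := RKHS.ext fun w => by rw [hG, hΛ, hΓ, hF]
    rw [hGA, hGF, hΓM, hΓ, ← hFA, ← hΛ]
    rfl
  · rw [a.C_eq, b.C_eq, hΛ]

end CoincidentMultipliers

/-! ### The transfer function of the canonical modification -/

section TransferFunctions

open Colligation

variable {d : ℕ} {U Y V W : Type*}
  [NormedAddCommGroup U] [InnerProductSpace ℂ U] [CompleteSpace U]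
  [NormedAddCommGroup Y] [InnerProductSpace ℂ Y] [CompleteSpace Y]
  [NormedAddCommGroup V] [InnerProductSpace ℂ V] [CompleteSpace V]
  [NormedAddCommGroup W] [InnerProductSpace ℂ W] [CompleteSpace W]
  {φ : SchurMultiplier d U Y} {ψ : SchurMultiplier d V W}

namespace FunctionalModel

/-- The transfer function of the canonical modification is `φ(z) J`. -/
lemma canonical_apply (a : FunctionalModel φ) (z : Ball d) (n : a.N) :
    φ z (a.J n) = a.canonical.D n + (row φ.DeBrangesRovnyak z (a.canonical.B n)) z := by
  refine ext_inner_left ℂ fun y => ?_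
  have hproj : φ.DSpaceᗮ.orthogonalProjectionOnto (φ.shiftedKernel (.single z y)) = 0 :=
    φ.DSpace.orthogonalProjectionOnto_orthogonal_apply_eq_zero (φ.toDSpace (.single z y)).2
  have hB : a.BJadjoint (φ.shiftedKernel (.single z y))
      = a.J.adjoint ((φ z).adjoint y - (φ 0).adjoint y) := by
    rw [BJadjoint_apply, hproj, map_zero, map_zero, adjoint_B_shiftedKernel_single,
      adjoint_J_of_mem _ (sub_mem (adjoint_apply_mem z y) (adjoint_apply_mem 0 y))]
  have h1 : ⟪y, (row φ.DeBrangesRovnyak z (a.canonical.B n)) z⟫_ℂ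
      = ⟪a.BJadjoint (φ.shiftedKernel (.single z y)), n⟫_ℂ := by
    rw [← RKHS.kerFun_inner, ← ContinuousLinearMap.adjoint_inner_left,
      ← SchurMultiplier.shiftedKernel_single_eq, canonical,
      ContinuousLinearMap.adjoint_inner_right]
  rw [inner_add_right, h1, hB, ContinuousLinearMap.adjoint_inner_left, inner_sub_left,
    ContinuousLinearMap.adjoint_inner_left, ContinuousLinearMap.adjoint_inner_left]
  change _ = ⟪y, φ 0 (a.J n)⟫_ℂ + _
  ring

/-- An intertwining of output pairs acts on functions pointwise. -/
lemma apply_of_intertwinesOutput {a : FunctionalModel φ} {b : FunctionalModel ψ}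
    {Λ : φ.DeBrangesRovnyak ≃ₗᵢ[ℂ] ψ.DeBrangesRovnyak} {β : Y ≃ₗᵢ[ℂ] W}
    (h : IntertwinesOutput a.toColligation b.toColligation Λ β) (f : φ.DeBrangesRovnyak)
    (z : Ball d) : Λ f z = β (f z) := by
  -- `f(z) = C g` for `f = (I - Z A) g`
  obtain ⟨g, rfl⟩ : ∃ g, (1 - row φ.DeBrangesRovnyak z ∘L a.A) g = f := by
    have := Ring.mul_inverse_cancel _ (a.isUnit_one_sub a.contractive z)
    exact ⟨_, DFunLike.congr_fun this f⟩
  have h1 : ((1 - row φ.DeBrangesRovnyak z ∘L a.A) g) z = a.C g := by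
    rw [← a.adjoint_kerFun_comp z, ContinuousLinearMap.comp_apply, RKHS.adjoint_kerFun]
  have h2 : ((1 - row ψ.DeBrangesRovnyak z ∘L b.A) (Λ g)) z = b.C (Λ g) := by
    rw [← b.adjoint_kerFun_comp z, ContinuousLinearMap.comp_apply, RKHS.adjoint_kerFun]
  have h3 : Λ ((1 - row φ.DeBrangesRovnyak z ∘L a.A) g)
      = (1 - row ψ.DeBrangesRovnyak z ∘L b.A) (Λ g) := by
    simp only [sub_apply, one_apply_eq_self, ContinuousLinearMap.comp_apply, map_sub]
    rw [← h.1, map_row]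
  rw [h1, h3, h2, h.2]

/-- A unitary coincidence intertwines the transfer functions `φ(z) J` and `ψ(z) J'`. -/
lemma apply_J_of_unitarilyCoincident {a : FunctionalModel φ} {b : FunctionalModel ψ} {H : Type*}
    [NormedAddCommGroup H] [InnerProductSpace ℂ H]
    (h : (a.canonical.augment H).UnitarilyCoincident b.canonical) :
    ∃ (Ω : WithLp 2 (a.N × H) ≃ₗᵢ[ℂ] b.N) (β : Y ≃ₗᵢ[ℂ] W),
      ∀ z n, β (φ z (a.J n.fst)) = ψ z (b.J (Ω n)) := by
  obtain ⟨Λ, Ω, β, h⟩ := h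
  have hout : IntertwinesOutput a.toColligation b.toColligation Λ β := by
    refine ⟨fun x => ?_, fun x => ?_⟩
    · have := (h x 0).1
      simp only [map_zero, add_zero] at this
      exact this
    · have := (h x 0).2
      simp only [map_zero, add_zero] at this
      exact this
  refine ⟨Ω, β, fun z n => ?_⟩
  have hB := (h 0 n).1
  have hD := (h 0 n).2
  simp only [map_zero, zero_add] at hB hD
  change LinearIsometryEquiv.piLpCongrRight 2 (fun _ => Λ) (a.canonical.B n.fst) = _ at hB
  change β (a.canonical.D n.fst) = _ at hD
  rw [canonical_apply, canonical_apply, map_add, hD, ← apply_of_intertwinesOutput hout, ← map_row,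
    hB]

lemma J_apply_of_mem (a : FunctionalModel φ) {u : U} (hu : u ∈ φ.nullSpaceᗮ)
    (k : a.DefectSpace) : a.J (WithLp.toLp 2 (u, k)) = u :=
  Submodule.starProjection_eq_self_iff.2 hu

lemma norm_J_le (a : FunctionalModel φ) (n : a.N) : ‖a.J n‖ ≤ ‖n‖ :=
  (Submodule.norm_starProjection_apply_le _ _).trans (WithLp.norm_fst_le _ _)

lemma J_mem (a : FunctionalModel φ) (n : a.N) : a.J n ∈ φ.nullSpaceᗮ :=
  Submodule.starProjection_apply_mem _ _

end FunctionalModel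

lemma SchurMultiplier.eq_of_mem_orthogonal {u u' : U} (hu : u ∈ φ.nullSpaceᗮ)
    (hu' : u' ∈ φ.nullSpaceᗮ) (h : ∀ z, φ z u = φ z u') : u = u' := by
  have h1 : u - u' ∈ φ.nullSpace := (FunctionalModel.mem_nullSpace_iff _).2 fun z => by
    rw [map_sub, h, sub_self]
  exact sub_eq_zero.1 (inner_self_eq_zero.1 (Submodule.inner_right_of_mem_orthogonal h1
    (sub_mem hu hu')))

open FunctionalModel in
/-- A unitary coincidence of canonical modifications restricts to a unitary operator between the
complements of the null spaces that intertwines the multipliers. -/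
lemma exists_orthogonal_equiv {a : FunctionalModel φ} {b : FunctionalModel ψ} {H : Type*}
    [NormedAddCommGroup H] [InnerProductSpace ℂ H]
    (h : (a.canonical.augment H).UnitarilyCoincident b.canonical) :
    ∃ (ω : φ.nullSpaceᗮ ≃ₗᵢ[ℂ] ψ.nullSpaceᗮ) (β : Y ≃ₗᵢ[ℂ] W),
      ∀ z (u : φ.nullSpaceᗮ), β (φ z u) = ψ z (ω u) := by
  obtain ⟨Ω, β, h⟩ := apply_J_of_unitarilyCoincident h
  let f : φ.nullSpaceᗮ → ψ.nullSpaceᗮ := fun u =>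
    ⟨b.J (Ω (WithLp.toLp 2 (WithLp.toLp 2 ((u : U), (0 : a.DefectSpace)), (0 : H)))), b.J_mem _⟩
  let g : ψ.nullSpaceᗮ → φ.nullSpaceᗮ := fun v =>
    ⟨a.J (Ω.symm (WithLp.toLp 2 ((v : V), (0 : b.DefectSpace)))).fst, a.J_mem _⟩
  have hf : ∀ z u, ψ z (f u) = β (φ z u) := fun z u => by
    rw [← h]
    exact congrArg (fun t => β (φ z t)) (a.J_apply_of_mem u.2 0)
  have hg : ∀ z v, φ z (g v) = β.symm (ψ z v) := fun z v => by
    rw [LinearIsometryEquiv.eq_symm_apply, h, LinearIsometryEquiv.apply_symm_apply,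
      b.J_apply_of_mem v.2]
  have hfn : ∀ u, ‖f u‖ ≤ ‖u‖ := fun u => by
    refine (b.norm_J_le _).trans_eq ?_
    rw [LinearIsometryEquiv.norm_map]
    simp
  have hgn : ∀ v, ‖g v‖ ≤ ‖v‖ := fun v => by
    refine (a.norm_J_le _).trans ((WithLp.norm_fst_le _ _).trans_eq ?_)
    rw [LinearIsometryEquiv.norm_map]
    simp
  have hgf : ∀ u, g (f u) = u := fun u =>
    Subtype.ext (SchurMultiplier.eq_of_mem_orthogonal (g _).2 u.2 fun z => by
      rw [hg, hf, LinearIsometryEquiv.symm_apply_apply])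
  have hfg : ∀ v, f (g v) = v := fun v =>
    Subtype.ext (SchurMultiplier.eq_of_mem_orthogonal (f _).2 v.2 fun z => by
      rw [hf, hg, LinearIsometryEquiv.apply_symm_apply])
  let ω : φ.nullSpaceᗮ ≃ₗ[ℂ] ψ.nullSpaceᗮ :=
    { toFun := f
      invFun := g
      map_add' := fun u u' =>
        Subtype.ext (SchurMultiplier.eq_of_mem_orthogonal (f _).2 (f u + f u').2 fun z => by
          simp [hf])
      map_smul' := fun t u =>
        Subtype.ext (SchurMultiplier.eq_of_mem_orthogonal (f _).2 (t • f u).2 fun z => by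
          simp [hf])
      left_inv := hgf
      right_inv := hfg }
  refine ⟨⟨ω, fun u => le_antisymm (hfn u) ?_⟩, β, fun z u => (hf z u).symm⟩
  have := hgn (f u)
  rwa [hgf] at this

open Cardinal in
/-- The unitary operators between the complements of the null spaces and, by equality of dimensions,
between the null spaces make up the operator `α` of a coincidence. -/
lemma coincide_of_unitarilyCoincident {U : Type u} {V : Type v}
    [NormedAddCommGroup U] [InnerProductSpace ℂ U] [CompleteSpace U]
    [NormedAddCommGroup V] [InnerProductSpace ℂ V] [CompleteSpace V]
    {φ : SchurMultiplier d U Y} {ψ : SchurMultiplier d V W} {a : FunctionalModel φ}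
    {b : FunctionalModel ψ} {H : Type*} [NormedAddCommGroup H] [InnerProductSpace ℂ H]
    (hdim : lift.{v} (hilbertDim φ.nullSpace) = lift.{u} (hilbertDim ψ.nullSpace))
    (h : (a.canonical.augment H).UnitarilyCoincident b.canonical) : Coincide φ ψ := by
  obtain ⟨τ⟩ := exists_equiv_of_hilbertDim_eq hdim
  obtain ⟨ω, β, hω⟩ := exists_orthogonal_equiv h
  let α : U ≃ₗᵢ[ℂ] V := φ.nullSpace.orthogonalDecomposition.trans
    ((LinearIsometryEquiv.withLpProdCongr 2 τ ω).trans ψ.nullSpace.orthogonalDecomposition.symm)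
  have hα : ∀ u, α u = (τ (φ.nullSpace.orthogonalProjectionOnto u) : V)
      + ω (φ.nullSpaceᗮ.orthogonalProjectionOnto u) := by
    intro u
    simp [α]
  refine ⟨α, β, fun z u => ?_⟩
  have h0 : φ z (φ.nullSpace.starProjection u) = 0 :=
    (FunctionalModel.mem_nullSpace_iff _).1 (Submodule.starProjection_apply_mem _ u) z
  have h1 : ψ z (τ (φ.nullSpace.orthogonalProjectionOnto u)) = 0 :=
    (FunctionalModel.mem_nullSpace_iff _).1 (SetLike.coe_mem _) z
  rw [hα, map_add, h1, zero_add, ← hω]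
  change β (φ z u) = β (φ z (φ.nullSpaceᗮ.starProjection u))
  conv_lhs => rw [← φ.nullSpace.starProjection_add_starProjection_orthogonal u, map_add, h0,
    zero_add]

end TransferFunctions

end DruryArvesonSchur

end

theorem theorem3p1 {d : ℕ} {U : Type u} {Y : Type y} {V : Type v} {W : Type w}
    [NormedAddCommGroup U] [InnerProductSpace ℂ U] [CompleteSpace U]
    [TopologicalSpace.SeparableSpace U]
    [NormedAddCommGroup Y] [InnerProductSpace ℂ Y] [CompleteSpace Y]
    [TopologicalSpace.SeparableSpace Y]
    [NormedAddCommGroup V] [InnerProductSpace ℂ V] [CompleteSpace V]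
    [TopologicalSpace.SeparableSpace V]
    [NormedAddCommGroup W] [InnerProductSpace ℂ W] [CompleteSpace W]
    [TopologicalSpace.SeparableSpace W]
    (φ : SchurMultiplier d U Y) (ψ : SchurMultiplier d V W)
    (hφ : Nonempty (FunctionalModel φ)) (hψ : Nonempty (FunctionalModel ψ)) :
    Coincide φ ψ ↔
      Cardinal.lift.{v} (hilbertDim φ.nullSpace) = Cardinal.lift.{u} (hilbertDim ψ.nullSpace) ∧
      ∀ (a : FunctionalModel φ) (b : FunctionalModel ψ),
        ∃ (H : Type) (_ : NormedAddCommGroup H) (_ : InnerProductSpace ℂ H)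
          (_ : CompleteSpace H) (_ : TopologicalSpace.SeparableSpace H),
          (a.canonical.augment H).UnitarilyCoincident b.canonical ∨
            (b.canonical.augment H).UnitarilyCoincident a.canonical := by
  constructor
  · rintro ⟨α, β, h⟩
    obtain ⟨τ⟩ := exists_nullSpace_equiv h
    refine ⟨lift_hilbertDim_eq τ, fun a b => ?_⟩
    obtain ⟨Λ, hΛ⟩ := exists_intertwinesOutput h a b
    have hcan : Colligation.IntertwinesOutput a.canonical b.canonical Λ β := hΛ
    exact hcan.exists_augment a.canonical_isCoisometric b.canonical_isCoisometric
  · rintro ⟨hdim, h⟩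
    obtain ⟨a⟩ := hφ
    obtain ⟨b⟩ := hψ
    obtain ⟨H, _, _, _, _, hab | hba⟩ := h a b
    · exact coincide_of_unitarilyCoincident hdim hab
    · exact (coincide_of_unitarilyCoincident hdim.symm hba).symm
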